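/- Let $I$ be a finite set. A forest on $I$ is a set of rooted binary trees whose leaves are bijectively labelled by $I$; $V(F)$ denotes the set of inner vertices of the forest $F$. An inner orientation of $F$ consists of an orientation (a generator of the top exterior power) $o$ of $V(F)\sqcup\{R\}$, where $R$ is an auxiliary element, and of an orientation of the three half-edges at each inner vertex. Let $\operatorname{Bess}(I)$ be the $\mathbb{Q}$-vector space spanned by the inner-oriented forests $o\otimes F$ on $I$, reversing any one of the orientations being identified with multiplication by $-1$; it is graded by the number of inner vertices. The spaces $\operatorname{Bess}(I)$ form a graded operad (with Koszul signs), generated by $E_{i,j}$, symmetric of degree $0$, the forest on $\{i,j\}$ without inner vertex, and $\Omega_{i,j}$, antisymmetric of degree $1$, the tree on $\{i,j\}$ with one inner vertex $v$ and orientations $R\wedge v$ and $\mathrm{root}\wedge i\wedge j$. Acting with $E$ on two forests gives their disjoint union. Acting with $\Omega$ on two forests $F_1,F_2$ gives the sum, over all pairs of a tree $T_1$ of $F_1$ and a tree $T_2$ of $F_2$, of the forests obtained from $F_1\sqcup F_2$ by grafting $T_1$ and $T_2$ onto a new inner vertex $v$. The local orientations are $\mathrm{root}\wedge T_1\wedge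 T_2$ at $v$ and unchanged at the other vertices; if the global orientations of $F_1$, $F_2$ are $R\wedge\alpha_1$ and $R\wedge\alpha_2$, that of the result is $R\wedge\alpha_1\wedge\alpha_2$ for $E$ and $R\wedge v\wedge\alpha_1\wedge\alpha_2$ for $\Omega$. The coproduct $\Delta:\operatorname{Bess}\to\operatorname{Bess}\otimes\operatorname{Bess}$ is the morphism of graded operads with $$\Delta(E_{i,j})=E_{i,j}\otimes E_{i,j},\qquad \Delta(\Omega_{i,j})=E_{i,j}\otimes\Omega_{i,j}+\Omega_{i,j}\otimes E_{i,j}.$$ Let $\operatorname{Bess}^*(I)$ be the dual vector space of $\operatorname{Bess}(I)$, with the product $\langle\varphi\times\psi,x\rangle=\sum\langle\varphi,x'\rangle\langle\psi,x''\rangle$, where $\Delta(x)=\sum x'\otimes x''$. For distinct $i,j\in I$ let $Y_{i,j}\in\operatorname{Bess}^*(I)$ be the element of the dual basis given by the forest on $I$ with exactly one inner vertex $v$, which joins the leaves $i$ and $j$, with orientations $R\wedge v$ and $\mathrm{root}\wedge i\wedge j$. **Proposition.** Let $i,j,k,\ell$ be four distinct elements of $I$. Then, in $\operatorname{Bess}^*(I)$,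 $$\sum Y_{i_1,i_2}\times Y_{i_2,i_3}\times Y_{i_3,i_4}=0,$$ where the sum is over the set of total orders $i_1<i_2<i_3<i_4$ on $\{i,j,k,\ell\}$ up to reversal: it has $12$ terms, one for each pair formed by a total order and its reverse, and it vanishes for every choice of a representative in each pair. -/

import Mathlib

open scoped TensorProduct

noncomputable section

namespace Bessel

set_option linter.unusedSimpArgs false

universe u

/-- Leaf-labelled rooted binary trees, drawn in the plane. The drawing is not part of the
structure of the tree; it records the local orientation `root ∧ left ∧ right` at every inner vertex, and (by
listing the inner vertices in prefix order) an order of the inner vertices. -/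
inductive BTree (I : Type u) : Type u
  | leaf : I → BTree I
  | node : BTree I → BTree I → BTree I
  deriving DecidableEq

variable {I : Type u}

/-- The degree: the number of inner vertices. -/
def BTree.deg : BTree I → ℕ
  | .leaf _ => 0
  | .node l r => 1 + l.deg + r.deg

/-- The leaves, with multiplicity. -/
def BTree.leaves : BTree I → Multiset I
  | .leaf i => {i}
  | .node l r => l.leaves + r.leaves

/-- A drawn forest `[T₁, …, Tₙ]`. It stands for the inner-oriented forest `o ⊗ {T₁, …, Tₙ}` with
global orientation `o = R ∧ v₁ ∧ ⋯ ∧ vₘ`, where `v₁, …, vₘ` are the inner vertices of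
`T₁`, then of `T₂`, …, each tree being read in prefix order (vertex, left branch, right branch),
and with local orientation `root ∧ left ∧ right` at each inner vertex. -/
abbrev Drawn (I : Type u) : Type u := List (BTree I)

/-- The degree of a drawn forest: its number of inner vertices. -/
def fdeg (w : Drawn I) : ℕ := (w.map BTree.deg).sum

/-- The leaves of a drawn forest, with multiplicity. -/
def fleaves (w : Drawn I) : Multiset I := (w.map BTree.leaves).sum

/-- The sign `(-1) ^ n`. -/
def sgn (n : ℕ) : ℚ := (-1) ^ n

/-- `TreeFlip c T T'`: the drawing `T'` is obtained from `T` by exchanging the two branches at one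
inner vertex. The inner orientations they carry differ by the sign `c`: the local orientation
at that vertex is reversed, and the inner vertices of the two branches are
exchanged in the global orientation. -/
inductive TreeFlip : ℚ → BTree I → BTree I → Prop
  | swap (l r : BTree I) : TreeFlip (-sgn (l.deg * r.deg)) (.node l r) (.node r l)
  | left {c : ℚ} {l l' : BTree I} (r : BTree I) :
      TreeFlip c l l' → TreeFlip c (.node l r) (.node l' r)
  | right {c : ℚ} (l : BTree I) {r r' : BTree I} :
      TreeFlip c r r' → TreeFlip c (.node l r) (.node l r')

/-- `Flip c w w'`: the drawings `w`, `w'` differ by one elementary move (exchange of two consecutive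
trees, or of the two branches at an inner vertex), so that they are drawings of the same forest,
and the inner orientations they carry differ by the sign `c`. -/
inductive Flip : ℚ → Drawn I → Drawn I → Prop
  | exch (t s : BTree I) (v : Drawn I) : Flip (sgn (t.deg * s.deg)) (t :: s :: v) (s :: t :: v)
  | tree {c : ℚ} {t t' : BTree I} (v : Drawn I) : TreeFlip c t t' → Flip c (t :: v) (t' :: v)
  | cons {c : ℚ} (t : BTree I) {v v' : Drawn I} : Flip c v v' → Flip c (t :: v) (t :: v')

/-! ### The action of the generators on forests, before orientations are identified -/

/-- Formal linear combinations of drawn forests. -/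
abbrev Lin (I : Type u) : Type u := Drawn I →₀ ℚ

/-- Formal linear combinations of pairs of drawn forests, `(a, b)` standing for `a ⊗ b`. -/
abbrev Lin2 (I : Type u) : Type u := (Drawn I × Drawn I) →₀ ℚ

/-- Bilinear extension of a map given on basis elements. -/
def bilin {α β M : Type*} [AddCommGroup M] [Module ℚ M] (f : α → β → M) :
    (α →₀ ℚ) →ₗ[ℚ] (β →₀ ℚ) →ₗ[ℚ] M :=
  Finsupp.linearCombination ℚ (fun a => Finsupp.linearCombination ℚ (f a))

/-- The disjoint union with a drawn forest `u` placed first. -/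
def pre (u : Drawn I) : Lin I →ₗ[ℚ] Lin I := Finsupp.lmapDomain ℚ ℚ (fun w => u ++ w)

/-- `Ω_{⋆,#} ∘_⋆ t ∘_# v` for a tree `t` and a forest `v`: the sum over all trees `s` of `v` of the
forest in which `s` is replaced by `t ∨ s`. -/
def graftTree (t : BTree I) : Drawn I → Lin I
  | [] => 0
  | s :: v => Finsupp.single (.node t s :: v) 1
      + sgn ((1 + t.deg) * s.deg) • pre [s] (graftTree t v)

/-- `Ω_{⋆,#} ∘_⋆ u ∘_# v` for two forests `u` and `v`: the sum over all pairs of a tree `t`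
of `u` and a tree `s` of `v` of the forest in which `t` and `s` are replaced by `t ∨ s`,
oriented by `(-1)^{o₁} o₁ ∧ o₂` modulo `R₁ ∧ R₂ = R ∧ vertex`. -/
def graft : Drawn I → Drawn I → Lin I
  | [], _ => 0
  | t :: u, v => sgn ((1 + t.deg) * fdeg u) • pre u (graftTree t v)
      + sgn t.deg • pre [t] (graft u v)

/-- The tensor product of two linear combinations. -/
def tens : Lin I →ₗ[ℚ] Lin I →ₗ[ℚ] Lin2 I := bilin fun a b => Finsupp.single (a, b) 1

/-- `(E ⊗ E) ∘_⋆ (x' ⊗ x'') ∘_# (y' ⊗ y'')`, with the Koszul sign. Here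
`E_{⋆,#} ∘_⋆ u ∘_# v` is the disjoint union `u ++ v`. -/
def opE : Lin2 I →ₗ[ℚ] Lin2 I →ₗ[ℚ] Lin2 I :=
  bilin fun x y => sgn (fdeg x.2 * fdeg y.1) • Finsupp.single (x.1 ++ y.1, x.2 ++ y.2) 1

/-- `(Ω ⊗ E + E ⊗ Ω) ∘_⋆ (x' ⊗ x'') ∘_# (y' ⊗ y'')`, with the Koszul signs. -/
def opOmega : Lin2 I →ₗ[ℚ] Lin2 I →ₗ[ℚ] Lin2 I :=
  bilin fun x y =>
    sgn (fdeg x.2 * fdeg y.1) •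
        tens (graft x.1 y.1) (Finsupp.single (x.2 ++ y.2) 1)
      + sgn (fdeg x.1 + (1 + fdeg x.2) * fdeg y.1) •
        tens (Finsupp.single (x.1 ++ y.1) 1) (graft x.2 y.2)

/-- The coproduct of a tree: the operad morphism with `Δ E = E ⊗ E` and
`Δ Ω = E ⊗ Ω + Ω ⊗ E` applied to the expression of the tree through `Ω` (and the unit of the
operad, on a single leaf). -/
def coprodTree : BTree I → Lin2 I
  | .leaf i => Finsupp.single ([.leaf i], [.leaf i]) 1
  | .node l r => opOmega (coprodTree l) (coprodTree r)

/-- The coproduct of a forest: the same operad morphism applied to the expression of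
the forest as an iterated `E` of its trees. -/
def coprodDrawn : Drawn I → Lin2 I
  | [] => Finsupp.single ([], []) 1
  | t :: w => opE (coprodTree t) (coprodDrawn w)

/-! ### Signs, degrees, leaves -/

theorem sgn_add (a b : ℕ) : sgn (a + b) = sgn a * sgn b := pow_add _ _ _

theorem sgn_or (a : ℕ) : sgn a = 1 ∨ sgn a = -1 := neg_one_pow_eq_or ℚ a

theorem sgn_mul (a b : ℕ) : sgn (a * b) = if sgn a = 1 then 1 else sgn b := by
  rcases sgn_or a with h | h
  · rw [if_pos h]; unfold sgn at *; rw [pow_mul, h, one_pow]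
  · rw [if_neg (by rw [h]; norm_num)]; unfold sgn at *; rw [pow_mul, h]

theorem sgn_mul' (a b : ℕ) : sgn (a * b) = sgn (b * a) := by rw [mul_comm]

@[simp] theorem fdeg_nil : fdeg ([] : Drawn I) = 0 := rfl
@[simp] theorem fdeg_cons (t : BTree I) (w : Drawn I) : fdeg (t :: w) = t.deg + fdeg w := by
  simp [fdeg]
@[simp] theorem fdeg_append (u w : Drawn I) : fdeg (u ++ w) = fdeg u + fdeg w := by
  simp [fdeg]

theorem TreeFlip.deg {c : ℚ} {t t' : BTree I} (h : TreeFlip c t t') : t.deg = t'.deg := by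
  induction h with
  | swap l r => simp only [BTree.deg]; omega
  | left r _ ih => simp only [BTree.deg, ih]
  | right l _ ih => simp only [BTree.deg, ih]

theorem TreeFlip.leaves {c : ℚ} {t t' : BTree I} (h : TreeFlip c t t') :
    t.leaves = t'.leaves := by
  induction h with
  | swap l r => simp only [BTree.leaves, add_comm]
  | left r _ ih => simp only [BTree.leaves, ih]
  | right l _ ih => simp only [BTree.leaves, ih]

theorem Flip.fdeg {c : ℚ} {w w' : Drawn I} (h : Flip c w w') : fdeg w = fdeg w' := by
  induction h with
  | exch t s v => simp only [fdeg_cons]; omega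
  | tree v h => simp only [fdeg_cons, h.deg]
  | cons t _ ih => simp only [fdeg_cons, ih]

theorem Flip.fleaves {c : ℚ} {w w' : Drawn I} (h : Flip c w w') : fleaves w = fleaves w' := by
  induction h with
  | exch t s v => simp only [Bessel.fleaves, List.map_cons, List.sum_cons]; rw [add_left_comm]
  | tree v h => simp only [Bessel.fleaves, List.map_cons, List.sum_cons, h.leaves]
  | cons t _ ih =>
    simp only [Bessel.fleaves, List.map_cons, List.sum_cons] at ih ⊢; rw [ih]

theorem Flip.append_left {c : ℚ} {w w' : Drawn I} (u : Drawn I) (h : Flip c w w') :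
    Flip c (u ++ w) (u ++ w') := by
  induction u with
  | nil => exact h
  | cons t u ih => exact .cons t ih

theorem Flip.append_right {c : ℚ} {w w' : Drawn I} (u : Drawn I) (h : Flip c w w') :
    Flip c (w ++ u) (w' ++ u) := by
  induction h with
  | exch t s v => exact .exch t s _
  | tree v h => exact .tree _ h
  | cons t _ ih => exact .cons t ih

/-! ### `Ω` respects the identification of orientations -/

/-- The identification of orientations, on linear combinations of drawn forests. -/
def rel (I : Type u) : Submodule ℚ (Lin I) :=
  Submodule.span ℚ {x | ∃ c w w', Flip c w w' ∧
    x = Finsupp.single w 1 - c • Finsupp.single w' 1}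

/-- Linear combinations of drawn forests modulo the identification of orientations. -/
abbrev Quo (I : Type u) : Type u := Lin I ⧸ rel I

/-- The class of a drawn forest. -/
def cl (w : Drawn I) : Quo I := (rel I).mkQ (Finsupp.single w 1)

theorem cl_flip {c : ℚ} {w w' : Drawn I} (h : Flip c w w') : cl w = c • cl w' := by
  unfold cl
  rw [← map_smul, ← sub_eq_zero, ← map_sub]
  exact (Submodule.Quotient.mk_eq_zero _).2 (Submodule.subset_span ⟨c, w, w', h, rfl⟩)

theorem quo_hom_ext {M : Type*} [AddCommGroup M] [Module ℚ M] {f g : Quo I →ₗ[ℚ] M}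
    (h : ∀ w, f (cl w) = g (cl w)) : f = g := by
  apply Submodule.linearMap_qext
  apply Finsupp.lhom_ext'
  intro w
  ext
  exact h w

theorem rel_le_ker {M : Type*} [AddCommGroup M] [Module ℚ M] (f : Lin I →ₗ[ℚ] M)
    (h : ∀ c w w', Flip c w w' → f (Finsupp.single w 1) = c • f (Finsupp.single w' 1)) :
    rel I ≤ LinearMap.ker f := by
  apply Submodule.span_le.2
  rintro _ ⟨c, w, w', hw, rfl⟩
  simp only [SetLike.mem_coe, LinearMap.mem_ker, map_sub, map_smul, h c w w' hw, sub_self]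

theorem pre_single (u w : Drawn I) :
    pre u (Finsupp.single w 1) = Finsupp.single (u ++ w) 1 := by
  simp [pre, Finsupp.lmapDomain_apply, Finsupp.mapDomain_single]

/-- `pre` on classes. -/
def preQ (u : Drawn I) : Quo I →ₗ[ℚ] Quo I :=
  (rel I).liftQ ((rel I).mkQ ∘ₗ pre u) (rel_le_ker _ fun c w w' h => by
    simp only [LinearMap.comp_apply, pre_single]
    exact cl_flip (h.append_left u))

theorem preQ_mk (u : Drawn I) (x : Lin I) : (rel I).mkQ (pre u x) = preQ u ((rel I).mkQ x) := rfl

theorem preQ_cl (u w : Drawn I) : preQ u (cl w) = cl (u ++ w) := by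
  unfold cl; rw [← preQ_mk, pre_single]

theorem preQ_append (u v : Drawn I) (x : Quo I) : preQ (u ++ v) x = preQ u (preQ v x) := by
  have : preQ (u ++ v) = preQ u ∘ₗ preQ v := quo_hom_ext fun w => by
    simp [preQ_cl]
  rw [this]; rfl

theorem preQ_cons (t : BTree I) (v : Drawn I) (x : Quo I) :
    preQ (t :: v) x = preQ [t] (preQ v x) := preQ_append [t] v x

theorem preQ_nil (x : Quo I) : preQ [] x = x := by
  have : preQ ([] : Drawn I) = LinearMap.id := quo_hom_ext fun w => by simp [preQ_cl]
  rw [this]; rfl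

theorem preQ_flip {c : ℚ} {u u' : Drawn I} (h : Flip c u u') (x : Quo I) :
    preQ u x = c • preQ u' x := by
  have : preQ u = c • preQ u' := quo_hom_ext fun w => by
    simp [preQ_cl, cl_flip (h.append_right w)]
  rw [this]; rfl

theorem preQ_exch (t s : BTree I) (x : Quo I) :
    preQ [t] (preQ [s] x) = sgn (t.deg * s.deg) • preQ [s] (preQ [t] x) := by
  rw [← preQ_append, ← preQ_append]; exact preQ_flip (.exch t s []) x

theorem preQ_exch_left (t : BTree I) (v : Drawn I) (x : Quo I) :
    preQ [t] (preQ v x) = sgn (t.deg * fdeg v) • preQ v (preQ [t] x) := by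
  induction v generalizing x with
  | nil => simp [preQ_nil, sgn]
  | cons s v ih =>
    rw [preQ_cons s v, preQ_cons s v, preQ_exch, ih, map_smul, smul_smul, fdeg_cons, mul_add,
      sgn_add]

theorem preQ_comm (u v : Drawn I) (x : Quo I) :
    preQ u (preQ v x) = sgn (fdeg u * fdeg v) • preQ v (preQ u x) := by
  induction u generalizing x with
  | nil => simp [preQ_nil, sgn]
  | cons t u ih =>
    rw [preQ_cons t u, preQ_cons t u, ih, map_smul, preQ_exch_left, smul_smul, fdeg_cons, add_mul,
      sgn_add, mul_comm]

theorem cl_cons (t : BTree I) (v : Drawn I) : cl (t :: v) = preQ [t] (cl v) := by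
  rw [preQ_cl]; rfl

theorem cl_comm (u v : Drawn I) : cl (u ++ v) = sgn (fdeg u * fdeg v) • cl (v ++ u) := by
  have := preQ_comm u v (cl [])
  simpa [preQ_cl] using this

theorem preQ_node (s t : BTree I) (v : Drawn I) : preQ [BTree.node s t] (cl v) =
    sgn ((1 + s.deg + t.deg) * fdeg v) • preQ v (cl [.node s t]) := by
  rw [preQ_cl, preQ_cl, cl_comm]; simp [BTree.deg]

/-- The class of `graftTree`. -/
def gT (t : BTree I) (v : Drawn I) : Quo I := (rel I).mkQ (graftTree t v)

/-- The class of `graft`. -/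
def gr (u v : Drawn I) : Quo I := (rel I).mkQ (graft u v)

theorem gT_nil (t : BTree I) : gT t [] = 0 := by simp [gT, graftTree]

theorem gT_cons (t s : BTree I) (v : Drawn I) :
    gT t (s :: v) = preQ [.node t s] (cl v)
      + sgn ((1 + t.deg) * s.deg) • preQ [s] (gT t v) := by
  unfold gT
  rw [graftTree, map_add, map_smul, preQ_mk, ← cl_cons]; rfl

theorem gr_nil (v : Drawn I) : gr [] v = 0 := by simp [gr, graft]

theorem gr_cons (t : BTree I) (u v : Drawn I) :
    gr (t :: u) v = sgn ((1 + t.deg) * fdeg u) • preQ u (gT t v)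
      + sgn t.deg • preQ [t] (gr u v) := by
  unfold gr gT
  rw [graft, map_add, map_smul, map_smul, preQ_mk, preQ_mk]

theorem gT_tree {c : ℚ} {t t' : BTree I} (h : TreeFlip c t t') (v : Drawn I) :
    gT t v = c • gT t' v := by
  induction v with
  | nil => simp [gT_nil]
  | cons s v ih =>
    rw [gT_cons, gT_cons, preQ_flip (.tree [] (h.left s)), ih, h.deg, map_smul, smul_add,
      smul_comm c]

theorem gT_flip (t : BTree I) {c : ℚ} {v v' : Drawn I} (h : Flip c v v') :
    gT t v = c • gT t v' := by
  induction h with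
  | exch a b v =>
    simp only [gT_cons, map_add, map_smul, cl_cons]
    rw [preQ_exch (.node t a) b, preQ_exch (.node t b) a, preQ_exch a b]
    simp only [smul_add, smul_smul, BTree.deg]
    have e1 : sgn (a.deg * b.deg) * (sgn ((1 + t.deg) * b.deg)) =
        sgn ((1 + t.deg + a.deg) * b.deg) := by
      rw [← sgn_add]; congr 1; ring
    have e2 : sgn (a.deg * b.deg) * sgn ((1 + t.deg + b.deg) * a.deg) =
        sgn ((1 + t.deg) * a.deg) := by
      rw [add_mul _ b.deg, sgn_add, mul_comm b.deg, mul_left_comm]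
      rcases sgn_or (a.deg * b.deg) with h | h <;> rw [h] <;> ring
    rw [e1, e2]
    rw [← e1]
    module
  | tree v h =>
    simp only [gT_cons]
    rw [preQ_flip (.tree [] (h.right t)), preQ_flip (.tree [] h), h.deg]
    module
  | cons s h ih =>
    simp only [gT_cons]
    rw [ih, cl_flip h]
    simp only [map_smul]
    module

theorem gr_flip_right (u : Drawn I) {c : ℚ} {v v' : Drawn I} (h : Flip c v v') :
    gr u v = c • gr u v' := by
  induction u with
  | nil => simp [gr_nil]
  | cons t u ih =>
    rw [gr_cons, gr_cons, ih, gT_flip t h]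
    simp only [map_smul]
    module

theorem gr_flip_left {c : ℚ} {u u' : Drawn I} (h : Flip c u u') (v : Drawn I) :
    gr u v = c • gr u' v := by
  induction h with
  | exch a b w =>
    simp only [gr_cons, map_add, map_smul, fdeg_cons, preQ_cons _ w, mul_add, sgn_add]
    rw [preQ_exch a b (gr w v)]
    simp only [smul_add, smul_smul, one_mul, mul_comm b.deg a.deg, add_mul, sgn_add]
    rcases sgn_or (a.deg * b.deg) with h | h <;> rw [h] <;> module
  | tree w h =>
    rw [gr_cons, gr_cons, gT_tree h, preQ_flip (.tree [] h), h.deg]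
    simp only [map_smul]
    module
  | cons t h ih =>
    rw [gr_cons, gr_cons, ih, preQ_flip h, h.fdeg]
    simp only [map_smul]
    module

theorem gr_singleton (v : Drawn I) (t : BTree I) :
    gr v [t] = -sgn (fdeg v * t.deg) • gT t v := by
  induction v with
  | nil => simp [gr_nil, gT_nil]
  | cons s v ih =>
    rw [gr_cons, gT_cons, ih, gT_cons, gT_nil, preQ_flip (.tree [] (.swap t s))]
    have e : preQ [BTree.node s t] (cl v) =
        sgn ((1 + s.deg + t.deg) * fdeg v) • preQ v (cl [.node s t]) :=
      preQ_node s t v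
    rw [e, cl_cons _ []]
    simp only [map_zero, smul_zero, add_zero, fdeg_cons, map_smul, smul_add, smul_smul, add_mul,
      one_mul, sgn_add, mul_comm t.deg s.deg, mul_comm t.deg (fdeg v)]
    rcases sgn_or (s.deg * t.deg) with h | h <;> rcases sgn_or (fdeg v * t.deg) with h' | h' <;>
      rw [h, h'] <;> module

theorem gr_cons_right (v : Drawn I) (t : BTree I) (u : Drawn I) :
    gr v (t :: u) = sgn ((1 + fdeg v + t.deg) * fdeg u) • preQ u (gr v [t])
      + sgn ((1 + fdeg v) * t.deg) • preQ [t] (gr v u) := by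
  induction v with
  | nil => simp [gr_nil]
  | cons s v ih =>
    have e : preQ [BTree.node s t] (cl u) =
        sgn ((1 + s.deg + t.deg) * fdeg u) • preQ u (cl [.node s t]) :=
      preQ_node s t u
    rw [gr_cons, gr_cons, gr_cons, ih, gT_cons, gT_cons, gT_nil, e, cl_cons _ []]
    simp only [map_add, map_smul, map_zero, smul_zero, add_zero]
    rw [preQ_comm v u, preQ_comm v [t], preQ_comm [s] u, preQ_comm [s] [t]]
    simp only [smul_add, smul_smul, fdeg_cons, fdeg_nil, add_zero, add_mul, mul_add, one_mul,
      sgn_add, mul_comm t.deg s.deg, mul_comm t.deg (fdeg v)]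
    rcases sgn_or (fdeg v * fdeg u) with h | h <;> rcases sgn_or (fdeg v * t.deg) with h' | h' <;>
      rcases sgn_or (s.deg * fdeg u) with h2 | h2 <;> rcases sgn_or (s.deg * t.deg) with h3 | h3 <;>
      rw [h, h', h2, h3] <;> module

theorem gr_antisymm (u v : Drawn I) : gr u v = -sgn (fdeg u * fdeg v) • gr v u := by
  induction u with
  | nil =>
    have : gr v [] = 0 := by
      induction v with
      | nil => exact gr_nil _
      | cons s v ih => rw [gr_cons, ih, gT_nil]; simp
    rw [this, gr_nil, smul_zero]
  | cons t u ih =>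
    rw [gr_cons_right, gr_cons, ih, gr_singleton]
    simp only [map_smul, smul_add, smul_smul, fdeg_cons, add_mul, one_mul, sgn_add,
      mul_comm t.deg (fdeg v), mul_comm (fdeg u) (fdeg v)]
    rcases sgn_or (fdeg v * fdeg u) with h | h <;> rcases sgn_or (fdeg v * t.deg) with h' | h' <;>
      rw [h, h'] <;> module

/-! ### The coproduct respects the identification of orientations -/

/-- The identification of orientations, on linear combinations of pairs. -/
def rel2 (I : Type u) : Submodule ℚ (Lin2 I) :=
  Submodule.span ℚ {x | ∃ c a a' b, Flip c a a' ∧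
    (x = Finsupp.single (a, b) 1 - c • Finsupp.single (a', b) 1 ∨
      x = Finsupp.single (b, a) 1 - c • Finsupp.single (b, a') 1)}

/-- Linear combinations of pairs modulo the identification of orientations. -/
abbrev Quo2 (I : Type u) : Type u := Lin2 I ⧸ rel2 I

theorem rel2_le_ker {M : Type*} [AddCommGroup M] [Module ℚ M] (f : Lin2 I →ₗ[ℚ] M)
    (h : ∀ c a a' b, Flip c a a' →
      f (Finsupp.single (a, b) 1) = c • f (Finsupp.single (a', b) 1) ∧
      f (Finsupp.single (b, a) 1) = c • f (Finsupp.single (b, a') 1)) :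
    rel2 I ≤ LinearMap.ker f := by
  apply Submodule.span_le.2
  rintro _ ⟨c, a, a', b, hw, rfl | rfl⟩
  · simp only [SetLike.mem_coe, LinearMap.mem_ker, map_sub, map_smul, (h c a a' b hw).1, sub_self]
  · simp only [SetLike.mem_coe, LinearMap.mem_ker, map_sub, map_smul, (h c a a' b hw).2, sub_self]

@[simp] theorem bilin_single {α β M : Type*} [AddCommGroup M] [Module ℚ M] (f : α → β → M)
    (a : α) (b : β) : bilin f (Finsupp.single a 1) (Finsupp.single b 1) = f a b := by
  simp [bilin]

theorem bilin_ext {α β M : Type*} [AddCommGroup M] [Module ℚ M]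
    {f g : (α →₀ ℚ) →ₗ[ℚ] (β →₀ ℚ) →ₗ[ℚ] M}
    (h : ∀ a b, f (Finsupp.single a 1) (Finsupp.single b 1) =
      g (Finsupp.single a 1) (Finsupp.single b 1)) : f = g := by
  apply Finsupp.lhom_ext'
  intro a
  ext1
  apply Finsupp.lhom_ext'
  intro b
  ext1
  exact h a b

theorem tens_single (a b : Drawn I) :
    tens (Finsupp.single a 1) (Finsupp.single b 1) = Finsupp.single (a, b) 1 :=
  bilin_single _ _ _

theorem mk2_flip {c : ℚ} {a a' : Drawn I} (b : Drawn I) (h : Flip c a a') :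
    (rel2 I).mkQ (Finsupp.single (a, b) 1) = c • (rel2 I).mkQ (Finsupp.single (a', b) 1) ∧
    (rel2 I).mkQ (Finsupp.single (b, a) 1) = c • (rel2 I).mkQ (Finsupp.single (b, a') 1) := by
  constructor
  · rw [← map_smul, ← sub_eq_zero, ← map_sub]
    exact (Submodule.Quotient.mk_eq_zero _).2
      (Submodule.subset_span ⟨c, a, a', b, h, .inl rfl⟩)
  · rw [← map_smul, ← sub_eq_zero, ← map_sub]
    exact (Submodule.Quotient.mk_eq_zero _).2
      (Submodule.subset_span ⟨c, a, a', b, h, .inr rfl⟩)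

/-- `tens` on classes, for a fixed drawn forest on the left. -/
def betaR (a : Drawn I) : Quo I →ₗ[ℚ] Quo2 I :=
  (rel I).liftQ ((rel2 I).mkQ ∘ₗ tens (Finsupp.single a 1)) (rel_le_ker _ fun c w w' h => by
    simp only [LinearMap.comp_apply, tens_single]
    exact (mk2_flip a h).2)

/-- `tens` on classes. -/
def beta : Quo I →ₗ[ℚ] Quo I →ₗ[ℚ] Quo2 I :=
  (rel I).liftQ (Finsupp.linearCombination ℚ betaR) (rel_le_ker _ fun c w w' h => by
    simp only [Finsupp.linearCombination_single, one_smul]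
    apply quo_hom_ext
    intro v
    have e : ∀ w : Drawn I, betaR w (cl v) = (rel2 I).mkQ (Finsupp.single (w, v) 1) := fun w => by
      rw [← tens_single]; rfl
    rw [LinearMap.smul_apply, e, e]
    exact (mk2_flip v h).1)

theorem beta_mk (x y : Lin I) :
    (rel2 I).mkQ (tens x y) = beta ((rel I).mkQ x) ((rel I).mkQ y) := by
  have : (tens (I := I)).compr₂ (rel2 I).mkQ = beta.compl₁₂ (rel I).mkQ (rel I).mkQ := by
    apply bilin_ext
    intro a b
    simp only [LinearMap.compr₂_apply, LinearMap.compl₁₂_apply]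
    have : beta ((rel I).mkQ (Finsupp.single a 1)) = betaR a := by
      change Finsupp.linearCombination ℚ betaR (Finsupp.single a 1) = betaR a
      simp
    rw [this]; rfl
  exact LinearMap.congr_fun₂ this x y

/-- The class of `opE`. -/
def qE : Lin2 I →ₗ[ℚ] Lin2 I →ₗ[ℚ] Quo2 I := opE.compr₂ (rel2 I).mkQ

/-- The class of `opOmega`. -/
def qO : Lin2 I →ₗ[ℚ] Lin2 I →ₗ[ℚ] Quo2 I := opOmega.compr₂ (rel2 I).mkQ

theorem qE_single (x y : Drawn I × Drawn I) :
    qE (Finsupp.single x 1) (Finsupp.single y 1) =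
      sgn (fdeg x.2 * fdeg y.1) • beta (cl (x.1 ++ y.1)) (cl (x.2 ++ y.2)) := by
  unfold cl
  rw [← beta_mk, tens_single, qE, LinearMap.compr₂_apply, opE, bilin_single, map_smul]

theorem qO_single (x y : Drawn I × Drawn I) :
    qO (Finsupp.single x 1) (Finsupp.single y 1) =
      sgn (fdeg x.2 * fdeg y.1) • beta (gr x.1 y.1) (cl (x.2 ++ y.2)) +
      sgn (fdeg x.1 + (1 + fdeg x.2) * fdeg y.1) • beta (cl (x.1 ++ y.1)) (gr x.2 y.2) := by
  unfold cl gr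
  rw [← beta_mk, ← beta_mk, qO, LinearMap.compr₂_apply, opOmega, bilin_single, map_add, map_smul,
    map_smul]

theorem lin2_hom_ext {M : Type*} [AddCommGroup M] [Module ℚ M] {f g : Lin2 I →ₗ[ℚ] M}
    (h : ∀ p, f (Finsupp.single p 1) = g (Finsupp.single p 1)) : f = g := by
  apply Finsupp.lhom_ext'
  intro p
  ext1
  exact h p

theorem congr_left {f : Lin2 I →ₗ[ℚ] Lin2 I →ₗ[ℚ] Quo2 I}
    (h : ∀ c a a' b y, Flip c a a' →
      f (Finsupp.single (a, b) 1) (Finsupp.single y 1) =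
        c • f (Finsupp.single (a', b) 1) (Finsupp.single y 1) ∧
      f (Finsupp.single (b, a) 1) (Finsupp.single y 1) =
        c • f (Finsupp.single (b, a') 1) (Finsupp.single y 1))
    {c : ℚ} {X X' : Lin2 I} (e : (rel2 I).mkQ X = c • (rel2 I).mkQ X') (Y : Lin2 I) :
    f X Y = c • f X' Y := by
  have hk : rel2 I ≤ LinearMap.ker f := rel2_le_ker _ fun c a a' b hw =>
    ⟨lin2_hom_ext fun y => (h c a a' b y hw).1, lin2_hom_ext fun y => (h c a a' b y hw).2⟩
  have hm : X - c • X' ∈ rel2 I := by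
    rw [← Submodule.Quotient.mk_eq_zero, ← Submodule.mkQ_apply, map_sub, map_smul, e, sub_self]
  have := LinearMap.congr_fun (LinearMap.mem_ker.1 (hk hm)) Y
  simpa [sub_eq_zero] using this

theorem congr_right {f : Lin2 I →ₗ[ℚ] Lin2 I →ₗ[ℚ] Quo2 I}
    (h : ∀ c a a' b y, Flip c a a' →
      f (Finsupp.single y 1) (Finsupp.single (a, b) 1) =
        c • f (Finsupp.single y 1) (Finsupp.single (a', b) 1) ∧
      f (Finsupp.single y 1) (Finsupp.single (b, a) 1) =
        c • f (Finsupp.single y 1) (Finsupp.single (b, a') 1))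
    {c : ℚ} {Y Y' : Lin2 I} (e : (rel2 I).mkQ Y = c • (rel2 I).mkQ Y') (X : Lin2 I) :
    f X Y = c • f X Y' :=
  congr_left (f := f.flip) h e X

theorem qE_congr_left {c : ℚ} {X X' : Lin2 I} (e : (rel2 I).mkQ X = c • (rel2 I).mkQ X')
    (Y : Lin2 I) : qE X Y = c • qE X' Y := by
  refine congr_left (fun c a a' b y h => ?_) e Y
  simp only [qE_single]
  rw [cl_flip (h.append_right y.1), cl_flip (h.append_right y.2), h.fdeg]
  simp only [map_smul, LinearMap.smul_apply]
  constructor <;> module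

theorem qE_congr_right {c : ℚ} {Y Y' : Lin2 I} (e : (rel2 I).mkQ Y = c • (rel2 I).mkQ Y')
    (X : Lin2 I) : qE X Y = c • qE X Y' := by
  refine congr_right (fun c a a' b y h => ?_) e X
  simp only [qE_single]
  rw [cl_flip (h.append_left y.1), cl_flip (h.append_left y.2), h.fdeg]
  simp only [map_smul, LinearMap.smul_apply]
  constructor <;> module

theorem qO_congr_left {c : ℚ} {X X' : Lin2 I} (e : (rel2 I).mkQ X = c • (rel2 I).mkQ X')
    (Y : Lin2 I) : qO X Y = c • qO X' Y := by
  refine congr_left (fun c a a' b y h => ?_) e Y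
  simp only [qO_single]
  rw [cl_flip (h.append_right y.1), cl_flip (h.append_right y.2), h.fdeg, gr_flip_left h y.1,
    gr_flip_left h y.2]
  simp only [map_smul, LinearMap.smul_apply]
  constructor <;> module

theorem qO_congr_right {c : ℚ} {Y Y' : Lin2 I} (e : (rel2 I).mkQ Y = c • (rel2 I).mkQ Y')
    (X : Lin2 I) : qO X Y = c • qO X Y' := by
  refine congr_right (fun c a a' b y h => ?_) e X
  simp only [qO_single]
  rw [cl_flip (h.append_left y.1), cl_flip (h.append_left y.2), h.fdeg, gr_flip_right y.1 h,
    gr_flip_right y.2 h]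
  simp only [map_smul, LinearMap.smul_apply]
  constructor <;> module

/-- The part of degree `n`. -/
def hom1 (I : Type u) (n : ℕ) : Submodule ℚ (Lin I) :=
  Submodule.span ℚ {x | ∃ w, fdeg w = n ∧ x = Finsupp.single w 1}

/-- The part of total degree `n`. -/
def hom2 (I : Type u) (n : ℕ) : Submodule ℚ (Lin2 I) :=
  Submodule.span ℚ {x | ∃ p : Drawn I × Drawn I, fdeg p.1 + fdeg p.2 = n ∧ x = Finsupp.single p 1}

theorem single_mem_hom1 (w : Drawn I) : Finsupp.single w 1 ∈ hom1 I (fdeg w) :=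
  Submodule.subset_span ⟨w, rfl, rfl⟩

theorem pre_mem (u : Drawn I) {n : ℕ} {x : Lin I} (hx : x ∈ hom1 I n) :
    pre u x ∈ hom1 I (fdeg u + n) := by
  have : hom1 I n ≤ (hom1 I (fdeg u + n)).comap (pre u) := by
    apply Submodule.span_le.2
    rintro _ ⟨w, rfl, rfl⟩
    rw [SetLike.mem_coe, Submodule.mem_comap, pre_single, ← fdeg_append]
    exact single_mem_hom1 _
  exact this hx

theorem graftTree_mem (t : BTree I) (v : Drawn I) :
    graftTree t v ∈ hom1 I (1 + t.deg + fdeg v) := by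
  induction v with
  | nil => exact Submodule.zero_mem _
  | cons s v ih =>
    refine Submodule.add_mem _ ?_ (Submodule.smul_mem _ _ ?_)
    · exact Submodule.subset_span ⟨_, by simp [BTree.deg, add_assoc], rfl⟩
    · have := pre_mem [s] ih
      convert this using 2
      simp; omega

theorem graft_mem (u v : Drawn I) : graft u v ∈ hom1 I (1 + fdeg u + fdeg v) := by
  induction u with
  | nil => exact Submodule.zero_mem _
  | cons t u ih =>
    refine Submodule.add_mem _ (Submodule.smul_mem _ _ ?_) (Submodule.smul_mem _ _ ?_)
    · convert pre_mem u (graftTree_mem t v) using 2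
      simp; omega
    · convert pre_mem [t] ih using 2
      simp; omega

theorem tens_mem {m n : ℕ} {x y : Lin I} (hx : x ∈ hom1 I m) (hy : y ∈ hom1 I n) :
    tens x y ∈ hom2 I (m + n) := by
  have h1 : ∀ a : Drawn I, fdeg a = m →
      hom1 I n ≤ (hom2 I (m + n)).comap (tens (Finsupp.single a 1)) := by
    intro a ha
    apply Submodule.span_le.2
    rintro _ ⟨w, rfl, rfl⟩
    rw [SetLike.mem_coe, Submodule.mem_comap, tens_single]
    exact Submodule.subset_span ⟨_, by simp [ha], rfl⟩
  have h2 : hom1 I m ≤ (hom2 I (m + n)).comap (tens.flip y) := by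
    apply Submodule.span_le.2
    rintro _ ⟨w, hw, rfl⟩
    exact h1 w hw hy
  exact h2 hx

theorem hom2_induction {m n : ℕ} {M : Type*} [AddCommGroup M] [Module ℚ M]
    (f : Lin2 I →ₗ[ℚ] Lin2 I →ₗ[ℚ] M) (S : Submodule ℚ M)
    (h : ∀ p q : Drawn I × Drawn I, fdeg p.1 + fdeg p.2 = m → fdeg q.1 + fdeg q.2 = n →
      f (Finsupp.single p 1) (Finsupp.single q 1) ∈ S)
    {X Y : Lin2 I} (hX : X ∈ hom2 I m) (hY : Y ∈ hom2 I n) : f X Y ∈ S := by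
  have h2 : hom2 I m ≤ S.comap (f.flip Y) := by
    apply Submodule.span_le.2
    rintro _ ⟨p, hp, rfl⟩
    have h1 : hom2 I n ≤ S.comap (f (Finsupp.single p 1)) := by
      apply Submodule.span_le.2
      rintro _ ⟨q, hq, rfl⟩
      exact h p q hp hq
    exact h1 hY
  exact h2 hX

theorem opOmega_mem {m n : ℕ} {X Y : Lin2 I} (hX : X ∈ hom2 I m) (hY : Y ∈ hom2 I n) :
    opOmega X Y ∈ hom2 I (1 + m + n) := by
  refine hom2_induction opOmega _ (fun p q hp hq => ?_) hX hY
  rw [opOmega, bilin_single]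
  refine Submodule.add_mem _ (Submodule.smul_mem _ _ ?_) (Submodule.smul_mem _ _ ?_)
  · convert tens_mem (graft_mem p.1 q.1) (single_mem_hom1 (p.2 ++ q.2)) using 2
    simp; omega
  · convert tens_mem (single_mem_hom1 (p.1 ++ q.1)) (graft_mem p.2 q.2) using 2
    simp; omega

theorem coprodTree_mem (t : BTree I) : coprodTree t ∈ hom2 I t.deg := by
  induction t with
  | leaf i => exact Submodule.subset_span ⟨_, by simp [BTree.deg], rfl⟩
  | node l r hl hr => exact opOmega_mem hl hr

theorem qO_antisymm {m n : ℕ} {X Y : Lin2 I} (hX : X ∈ hom2 I m) (hY : Y ∈ hom2 I n) :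
    qO X Y = -sgn (m * n) • qO Y X := by
  have := hom2_induction (qO + sgn (m * n) • qO.flip) ⊥ (fun p q hp hq => ?_) hX hY
  · rw [Submodule.mem_bot] at this
    simp only [LinearMap.add_apply, LinearMap.smul_apply, LinearMap.flip_apply] at this
    rw [neg_smul]; exact eq_neg_of_add_eq_zero_left this
  · rw [Submodule.mem_bot]
    simp only [LinearMap.add_apply, LinearMap.smul_apply, LinearMap.flip_apply]
    rw [qO_single, qO_single, gr_antisymm p.1, gr_antisymm p.2, cl_comm p.1, cl_comm p.2, ← hp, ← hq]
    simp only [map_smul, LinearMap.smul_apply, smul_add, smul_smul, add_mul, mul_add, one_mul,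
      sgn_add, mul_comm (fdeg q.2), mul_comm (fdeg q.1)]
    rcases sgn_or (fdeg p.1) with h1 | h1 <;> rcases sgn_or (fdeg p.2) with h2 | h2 <;>
      rcases sgn_or (fdeg q.1) with h3 | h3 <;> rcases sgn_or (fdeg q.2) with h4 | h4 <;>
      simp only [sgn_mul, h1, h2, h3, h4] <;> norm_num <;> abel

theorem opE_assoc (X Y Z : Lin2 I) : opE X (opE Y Z) = opE (opE X Y) Z := by
  have h : ∀ x y z : Drawn I × Drawn I,
      opE (Finsupp.single x 1) (opE (Finsupp.single y 1) (Finsupp.single z 1)) =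
      opE (opE (Finsupp.single x 1) (Finsupp.single y 1)) (Finsupp.single z 1) := by
    intro x y z
    simp only [opE, bilin_single, map_smul, LinearMap.smul_apply, smul_smul, fdeg_append, mul_add,
      add_mul, sgn_add, List.append_assoc]
    congr 1; ring
  have h2 : ∀ x y, (opE (Finsupp.single x 1)) ∘ₗ (opE (Finsupp.single y 1)) =
      opE (I := I) (opE (Finsupp.single x 1) (Finsupp.single y 1)) := fun x y =>
    lin2_hom_ext fun z => h x y z
  have h3 : ∀ x : Drawn I × Drawn I,
      (opE.compr₂ (opE (Finsupp.single x 1))).flip Z =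
        (opE.flip Z) ∘ₗ (opE (Finsupp.single x 1)) := fun x =>
    lin2_hom_ext fun y => LinearMap.congr_fun (h2 x y) Z
  have h4 : opE.flip (opE Y Z) = (opE.flip Z) ∘ₗ (opE.flip Y) :=
    lin2_hom_ext fun x => LinearMap.congr_fun (h3 x) Y
  exact LinearMap.congr_fun h4 X

theorem qE_comm {m n : ℕ} {X Y : Lin2 I} (hX : X ∈ hom2 I m) (hY : Y ∈ hom2 I n) :
    qE X Y = sgn (m * n) • qE Y X := by
  have := hom2_induction (qE - sgn (m * n) • qE.flip) ⊥ (fun p q hp hq => ?_) hX hY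
  · rw [Submodule.mem_bot] at this
    simp only [LinearMap.sub_apply, LinearMap.smul_apply, LinearMap.flip_apply] at this
    exact sub_eq_zero.1 this
  · rw [Submodule.mem_bot]
    simp only [LinearMap.sub_apply, LinearMap.smul_apply, LinearMap.flip_apply]
    rw [qE_single, qE_single, cl_comm p.1, cl_comm p.2, ← hp, ← hq]
    simp only [map_smul, LinearMap.smul_apply, smul_smul, add_mul, mul_add,
      sgn_add, mul_comm (fdeg q.2), mul_comm (fdeg q.1)]
    rcases sgn_or (fdeg p.1) with h1 | h1 <;> rcases sgn_or (fdeg p.2) with h2 | h2 <;>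
      rcases sgn_or (fdeg q.1) with h3 | h3 <;> rcases sgn_or (fdeg q.2) with h4 | h4 <;>
      simp only [sgn_mul, h1, h2, h3, h4] <;> norm_num

theorem coprodTree_flip {c : ℚ} {t t' : BTree I} (h : TreeFlip c t t') :
    (rel2 I).mkQ (coprodTree t) = c • (rel2 I).mkQ (coprodTree t') := by
  induction h with
  | swap l r => exact qO_antisymm (coprodTree_mem l) (coprodTree_mem r)
  | left r _ ih => exact qO_congr_left ih _
  | right l _ ih => exact qO_congr_right ih _

theorem coprodDrawn_flip {c : ℚ} {w w' : Drawn I} (h : Flip c w w') :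
    (rel2 I).mkQ (coprodDrawn w) = c • (rel2 I).mkQ (coprodDrawn w') := by
  induction h with
  | exch t s v =>
    simp only [coprodDrawn]
    rw [opE_assoc, opE_assoc]
    exact qE_congr_left (qE_comm (coprodTree_mem t) (coprodTree_mem s)) _
  | tree v h => exact qE_congr_left (coprodTree_flip h) _
  | cons t _ ih => exact qE_congr_right ih _

/-! ### The values of `Y` on drawn forests -/

/-- The value of `Y_{i,j}` on a drawn forest: a forest has one inner vertex and support `{i, j}` if
and only if its degree is one and it contains the tree with leaves `i` and `j`; this tree is
drawn with local orientation `root ∧ i ∧ j` or with the opposite orientation. -/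
def yVal [DecidableEq I] (i j : I) (w : Drawn I) : ℚ :=
  if fdeg w = 1 then
    (if BTree.node (.leaf i) (.leaf j) ∈ w then 1 else 0)
      - (if BTree.node (.leaf j) (.leaf i) ∈ w then 1 else 0)
  else 0

theorem deg_eq_zero {t : BTree I} (h : t.deg = 0) : ∃ a, t = .leaf a := by
  cases t with
  | leaf a => exact ⟨a, rfl⟩
  | node l r => simp [BTree.deg] at h

theorem flip_tree_one {c : ℚ} {t t' : BTree I} (h : TreeFlip c t t')
    (ht : t.deg = 1) : ∃ a b, c = -1 ∧ t = .node (.leaf a) (.leaf b) ∧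
      t' = .node (.leaf b) (.leaf a) := by
  cases h with
  | swap l r =>
    simp only [BTree.deg] at ht
    obtain ⟨a, rfl⟩ := deg_eq_zero (t := l) (by omega)
    obtain ⟨b, rfl⟩ := deg_eq_zero (t := r) (by omega)
    exact ⟨a, b, by simp [BTree.deg, sgn], rfl, rfl⟩
  | left r h =>
    simp only [BTree.deg] at ht
    rename_i l l'
    obtain ⟨a, rfl⟩ := deg_eq_zero (t := l) (by omega)
    cases h
  | right l h =>
    simp only [BTree.deg] at ht
    rename_i r r'
    obtain ⟨a, rfl⟩ := deg_eq_zero (t := r) (by omega)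
    cases h

theorem flip_zero {c : ℚ} {w w' : Drawn I} (h : Flip c w w') (hw : fdeg w = 0) : c = 1 := by
  induction h with
  | exch t s v =>
    rw [fdeg_cons] at hw
    have : t.deg = 0 := by omega
    simp [this, sgn]
  | @tree c t t' v h =>
    rw [fdeg_cons] at hw
    obtain ⟨a, rfl⟩ := deg_eq_zero (t := t) (by omega)
    cases h
  | cons t h ih =>
    rw [fdeg_cons] at hw
    exact ih (by omega)

theorem not_mem_of_fdeg {w : Drawn I} (h : fdeg w = 0) (a b : I) :
    BTree.node (.leaf a) (.leaf b) ∉ w := by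
  intro hm
  induction w with
  | nil => cases hm
  | cons s w ih =>
    rw [fdeg_cons] at h
    rcases List.mem_cons.1 hm with rfl | hm
    · simp [BTree.deg] at h
    · exact ih (by omega) hm

theorem yVal_flip [DecidableEq I] (i j : I) {c : ℚ} {w w' : Drawn I} (h : Flip c w w') :
    yVal i j w = c * yVal i j w' := by
  unfold yVal
  rw [← h.fdeg]
  by_cases hd : fdeg w = 1
  swap
  · rw [if_neg hd, if_neg hd, mul_zero]
  rw [if_pos hd, if_pos hd]
  induction h with
  | exch t s v =>
    simp only [fdeg_cons] at hd
    have : t.deg * s.deg = 0 := by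
      rcases Nat.eq_zero_or_pos t.deg with h | h
      · simp [h]
      · have : s.deg = 0 := by omega
        simp [this]
    rw [this]
    simp only [sgn, pow_zero, one_mul, List.mem_cons, or_left_comm]
  | @tree c t t' v h =>
    rw [fdeg_cons] at hd
    rcases Nat.eq_zero_or_pos t.deg with h0 | h0
    · obtain ⟨a, rfl⟩ := deg_eq_zero h0
      cases h
    · obtain ⟨a, b, rfl, rfl, rfl⟩ := flip_tree_one h (by omega)
      have hv : fdeg v = 0 := by omega
      simp only [List.mem_cons, not_mem_of_fdeg hv, or_false, BTree.node.injEq, BTree.leaf.injEq]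
      simp only [and_comm (a := j = a), and_comm (a := j = b)]
      ring
  | @cons c t v v' h ih =>
    rw [fdeg_cons] at hd
    rcases Nat.eq_zero_or_pos t.deg with h0 | h0
    · obtain ⟨a, rfl⟩ := deg_eq_zero h0
      have := ih (by simpa [BTree.deg] using hd)
      simpa using this
    · have hv : fdeg v = 0 := by omega
      have hv' : fdeg v' = 0 := h.fdeg ▸ hv
      simp [flip_zero h hv, not_mem_of_fdeg hv, not_mem_of_fdeg hv']

/-! ### The coalgebra `Bess(I)` and its dual algebra -/

section

variable [Fintype I]

/-- The drawn forests on the finite set `I`: every element of `I` labels exactly one leaf. -/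
def Forest (I : Type u) [Fintype I] : Type u :=
  {w : Drawn I // fleaves w = Finset.univ.val}

/-- The subspace spanned by the `o ⊗ F - c • (o' ⊗ F)` where `o = c • o'` are two inner
orientations of the same forest `F` on `I`. -/
def orientRel (I : Type u) [Fintype I] : Submodule ℚ (Forest I →₀ ℚ) :=
  Submodule.span ℚ {x | ∃ (c : ℚ) (w w' : Forest I), Flip c w.1 w'.1 ∧
    x = Finsupp.single w 1 - c • Finsupp.single w' 1}

/-- The vector space `Bess(I)`, spanned by the inner-oriented forests on `I`. -/
abbrev Bess (I : Type u) [Fintype I] : Type u := (Forest I →₀ ℚ) ⧸ orientRel I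

/-- The element of `Bess(I)` given by a drawn forest on `I`. -/
def ofForest (w : Forest I) : Bess I := (orientRel I).mkQ (Finsupp.single w 1)

open Classical in
/-- The element of `Bess(I)` given by a drawn forest if its set of leaves is `I`,
and `0` otherwise. -/
def ofDrawn (w : Drawn I) : Bess I :=
  if h : fleaves w = Finset.univ.val then ofForest ⟨w, h⟩ else 0

/-- The linear map `a ⊗ b ↦ a ⊗ b` from pairs of drawn forests to `Bess(I) ⊗ Bess(I)`. -/
def ofLin2 : Lin2 I →ₗ[ℚ] Bess I ⊗[ℚ] Bess I :=
  Finsupp.linearCombination ℚ fun p => ofDrawn p.1 ⊗ₜ[ℚ] ofDrawn p.2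

theorem ofForest_flip {c : ℚ} {w w' : Forest I} (h : Flip c w.1 w'.1) :
    ofForest w = c • ofForest w' := by
  unfold ofForest
  rw [← map_smul, ← sub_eq_zero, ← map_sub]
  exact (Submodule.Quotient.mk_eq_zero _).2 (Submodule.subset_span ⟨c, w, w', h, rfl⟩)

theorem ofDrawn_flip {c : ℚ} {w w' : Drawn I} (h : Flip c w w') :
    ofDrawn w = c • ofDrawn w' := by
  unfold ofDrawn
  by_cases hw : fleaves w = Finset.univ.val
  · have hw' : fleaves w' = Finset.univ.val := h.fleaves ▸ hw
    rw [dif_pos hw, dif_pos hw']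
    exact ofForest_flip h
  · have hw' : ¬ fleaves w' = Finset.univ.val := h.fleaves ▸ hw
    rw [dif_neg hw, dif_neg hw', smul_zero]

theorem rel2_le_ker_ofLin2 : rel2 I ≤ LinearMap.ker (ofLin2 (I := I)) :=
  rel2_le_ker _ fun c a a' b h => by
    simp only [ofLin2, Finsupp.linearCombination_single, one_smul]
    rw [ofDrawn_flip h, TensorProduct.smul_tmul', TensorProduct.tmul_smul]
    exact ⟨rfl, rfl⟩

theorem orientRel_le_ker {M : Type*} [AddCommGroup M] [Module ℚ M] (f : Forest I → M)
    (h : ∀ (c : ℚ) (w w' : Forest I), Flip c w.1 w'.1 → f w = c • f w') :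
    orientRel I ≤ LinearMap.ker (Finsupp.linearCombination ℚ f) := by
  apply Submodule.span_le.2
  rintro _ ⟨c, w, w', hw, rfl⟩
  simp [h c w w' hw]

theorem ofLin2_coprod_flip {c : ℚ} {w w' : Drawn I} (h : Flip c w w') :
    ofLin2 (coprodDrawn w) = c • ofLin2 (coprodDrawn w') := by
  have hm : coprodDrawn w - c • coprodDrawn w' ∈ rel2 I := by
    rw [← Submodule.Quotient.mk_eq_zero, ← Submodule.mkQ_apply, map_sub, map_smul,
      coprodDrawn_flip h, sub_self]
  have := LinearMap.mem_ker.1 (rel2_le_ker_ofLin2 hm)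
  simpa [sub_eq_zero] using this

/-- The coproduct `Δ : Bess(I) → Bess(I) ⊗ Bess(I)`. -/
def coprod (I : Type u) [Fintype I] : Bess I →ₗ[ℚ] Bess I ⊗[ℚ] Bess I :=
  (orientRel I).liftQ (Finsupp.linearCombination ℚ fun w => ofLin2 (coprodDrawn w.1))
    (orientRel_le_ker _ fun _ _ _ h => ofLin2_coprod_flip h)

/-- The dual vector space `Bess*(I)`. -/
abbrev BessDual (I : Type u) [Fintype I] : Type u := Module.Dual ℚ (Bess I)

/-- The product of `Bess*(I)`, the opposite of the product dual to the coproduct: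
`⟨φ × ψ, x⟩ = ∑ ⟨φ, x'⟩ ⟨ψ, x''⟩` where `Δ x = ∑ x' ⊗ x''`. -/
def times (φ ψ : BessDual I) : BessDual I :=
  LinearMap.mul' ℚ ℚ ∘ₗ TensorProduct.map φ ψ ∘ₗ coprod I

/-- The element `Y_{i,j}` of `Bess*(I)`: the element of the dual basis given by the forest on `I`
with one inner vertex `v` and support `{i, j}`, with global orientation `R ∧ v`
and local orientation `root ∧ i ∧ j`. -/
def Y [DecidableEq I] (i j : I) : BessDual I :=
  (orientRel I).liftQ (Finsupp.linearCombination ℚ fun w => yVal i j w.1)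
    (orientRel_le_ker _ fun _ _ _ h => yVal_flip i j h)

end

end Bessel

end

namespace Bessel

universe u

variable {I : Type u}

/-! ### Leaves of the terms of the coproduct -/

/-! Give each inner vertex a vector `c L R` depending biadditively on the leaves of its two
branches, and multiply these vectors in an exterior algebra in the order of the global orientation.
The Koszul signs of the operad are the signs of the exterior product. Summing over all ways to graft
is additive in the leaves, so the graft of two forests has weight `ι (c A B)` times the two weights,
where `A` and `B` are their sets of leaves. Hence the coproduct turns a pair of weight systems `c`,
`c'` into `c + c'` (`weight2_coprodDrawn`).

With `c L R = edgeVal a b (L, R) • m`, any forest with two or more inner vertices has weight zero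
because `ι m` squares to zero, and on the others the coefficient of `m` is the value of `Y a b`
(`weight_edgeHom`). Taking three independent vectors `m`, a product of three elements `Y` takes on a
forest the value zero unless there are three inner vertices. In that case it is the 3 by 3
determinant whose rows are the vertices and whose columns are the edges (`times_times_Y_ofForest`).

For a path, a nonzero determinant forces all inner vertices and all four points into one tree
(`exists_tree_of_edges`), which then has exactly these four leaves. In such a tree some vertex joins
two leaves `p` and `q`. Transposing `p` and `q` negates the row of this vertex and preserves the
other rows, so the determinants of the 24 orders cancel in pairs; `sum_pathDet_tree` verifies the
vanishing by evaluation on the five planar shapes. Reversing an order preserves its determinant, so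
a sum over representatives is half the sum over all orders. -/

/-- The span of the drawn forests with leaves `A`. -/
noncomputable def leafHom (A : Multiset I) : Submodule ℚ (Lin I) :=
  Submodule.span ℚ {x | ∃ w, fleaves w = A ∧ x = Finsupp.single w 1}

/-- The span of the pairs of drawn forests which both have leaves `A`. -/
noncomputable def leafHom2 (A : Multiset I) : Submodule ℚ (Lin2 I) :=
  Submodule.span ℚ {x | ∃ p : Drawn I × Drawn I, (fleaves p.1 = A ∧ fleaves p.2 = A) ∧
    x = Finsupp.single p 1}

@[simp] theorem fleaves_nil : fleaves ([] : Drawn I) = 0 := rfl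

@[simp] theorem fleaves_cons (t : BTree I) (w : Drawn I) :
    fleaves (t :: w) = t.leaves + fleaves w := by simp [fleaves]

@[simp] theorem fleaves_append (u w : Drawn I) :
    fleaves (u ++ w) = fleaves u + fleaves w := by simp [fleaves]

theorem single_mem_leafHom {w : Drawn I} {A : Multiset I} (h : fleaves w = A) :
    Finsupp.single w 1 ∈ leafHom A :=
  Submodule.subset_span ⟨w, h, rfl⟩

theorem pre_mem_leafHom (u : Drawn I) {A : Multiset I} {x : Lin I} (hx : x ∈ leafHom A) :
    pre u x ∈ leafHom (fleaves u + A) := by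
  have : leafHom A ≤ (leafHom (fleaves u + A)).comap (pre u) := by
    apply Submodule.span_le.2
    rintro _ ⟨w, rfl, rfl⟩
    rw [SetLike.mem_coe, Submodule.mem_comap, pre_single]
    exact single_mem_leafHom (fleaves_append u w)
  exact this hx

theorem graftTree_mem_leafHom (t : BTree I) (v : Drawn I) :
    graftTree t v ∈ leafHom (t.leaves + fleaves v) := by
  induction v with
  | nil => exact Submodule.zero_mem _
  | cons s v ih =>
    refine Submodule.add_mem _ ?_ (Submodule.smul_mem _ _ ?_)
    · exact single_mem_leafHom (by simp [BTree.leaves, add_assoc])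
    · convert pre_mem_leafHom [s] ih using 2
      simp [add_left_comm]

theorem graft_mem_leafHom (u v : Drawn I) : graft u v ∈ leafHom (fleaves u + fleaves v) := by
  induction u with
  | nil => exact Submodule.zero_mem _
  | cons t u ih =>
    refine Submodule.add_mem _ (Submodule.smul_mem _ _ ?_) (Submodule.smul_mem _ _ ?_)
    · convert pre_mem_leafHom u (graftTree_mem_leafHom t v) using 2
      simp [add_left_comm, add_assoc]
    · convert pre_mem_leafHom [t] ih using 2
      simp [add_assoc]

theorem tens_mem_leafHom2 {A : Multiset I} {x y : Lin I} (hx : x ∈ leafHom A)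
    (hy : y ∈ leafHom A) : tens x y ∈ leafHom2 A := by
  refine LinearMap.BilinMap.apply_apply_mem_of_mem_span (leafHom2 A) _ _ tens ?_ x y hx hy
  rintro _ ⟨u, hu, rfl⟩ _ ⟨v, hv, rfl⟩
  rw [tens_single]
  exact Submodule.subset_span ⟨(u, v), ⟨hu, hv⟩, rfl⟩

theorem opE_mem_leafHom2 {A B : Multiset I} {X Y : Lin2 I} (hX : X ∈ leafHom2 A)
    (hY : Y ∈ leafHom2 B) : opE X Y ∈ leafHom2 (A + B) := by
  refine LinearMap.BilinMap.apply_apply_mem_of_mem_span _ _ _ opE ?_ X Y hX hY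
  rintro _ ⟨p, ⟨hp, hp'⟩, rfl⟩ _ ⟨q, ⟨hq, hq'⟩, rfl⟩
  rw [opE, bilin_single]
  exact Submodule.smul_mem _ _ (Submodule.subset_span
    ⟨_, ⟨by simp [hp, hq], by simp [hp', hq']⟩, rfl⟩)

theorem opOmega_mem_leafHom2 {A B : Multiset I} {X Y : Lin2 I} (hX : X ∈ leafHom2 A)
    (hY : Y ∈ leafHom2 B) : opOmega X Y ∈ leafHom2 (A + B) := by
  refine LinearMap.BilinMap.apply_apply_mem_of_mem_span _ _ _ opOmega ?_ X Y hX hY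
  rintro _ ⟨p, ⟨hp, hp'⟩, rfl⟩ _ ⟨q, ⟨hq, hq'⟩, rfl⟩
  rw [opOmega, bilin_single]
  refine Submodule.add_mem _ (Submodule.smul_mem _ _ (tens_mem_leafHom2 ?_ ?_))
    (Submodule.smul_mem _ _ (tens_mem_leafHom2 ?_ ?_))
  · rw [← hp, ← hq]; exact graft_mem_leafHom _ _
  · exact single_mem_leafHom (by simp [hp', hq'])
  · exact single_mem_leafHom (by simp [hp, hq])
  · rw [← hp', ← hq']; exact graft_mem_leafHom _ _

theorem coprodTree_mem_leafHom2 (t : BTree I) : coprodTree t ∈ leafHom2 t.leaves := by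
  induction t with
  | leaf i => exact Submodule.subset_span ⟨_, ⟨by simp [BTree.leaves], by simp [BTree.leaves]⟩, rfl⟩
  | node l r hl hr => exact opOmega_mem_leafHom2 hl hr

theorem coprodDrawn_mem_leafHom2 (w : Drawn I) : coprodDrawn w ∈ leafHom2 (fleaves w) := by
  induction w with
  | nil => exact Submodule.subset_span ⟨_, ⟨rfl, rfl⟩, rfl⟩
  | cons t w ih =>
    rw [fleaves_cons]
    exact opE_mem_leafHom2 (coprodTree_mem_leafHom2 t) ih

/-! ### The inner vertices of a forest -/

/-- The leaves of the two branches at each inner vertex of a tree, in prefix order. -/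
def BTree.nodes : BTree I → List (Multiset I × Multiset I)
  | .leaf _ => []
  | .node l r => (l.leaves, r.leaves) :: (l.nodes ++ r.nodes)

/-- The leaves of the two branches at each inner vertex of a drawn forest, in its order. -/
def fnodes (w : Drawn I) : List (Multiset I × Multiset I) := w.flatMap BTree.nodes

@[simp] theorem fnodes_nil : fnodes ([] : Drawn I) = [] := rfl

@[simp] theorem fnodes_cons (t : BTree I) (w : Drawn I) :
    fnodes (t :: w) = t.nodes ++ fnodes w := rfl

@[simp] theorem fnodes_append (u w : Drawn I) : fnodes (u ++ w) = fnodes u ++ fnodes w := by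
  simp [fnodes]

theorem BTree.length_nodes (t : BTree I) : t.nodes.length = t.deg := by
  induction t with
  | leaf i => rfl
  | node l r hl hr => simp [BTree.nodes, BTree.deg, hl, hr]; omega

theorem length_fnodes (w : Drawn I) : (fnodes w).length = fdeg w := by
  induction w with
  | nil => rfl
  | cons t w ih => simp [ih, BTree.length_nodes]

/-! ### The exterior weight of a forest -/

section Weight

open ExteriorAlgebra

variable {N : Type*} [AddCommGroup N] [Module ℚ N]

/-- The exterior product of a list of vectors. -/
noncomputable def extProd (L : List N) : ExteriorAlgebra ℚ N := (L.map (ι ℚ)).prod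

theorem extProd_append (L L' : List N) : extProd (L ++ L') = extProd L * extProd L' := by
  simp [extProd]

theorem extProd_cons (m : N) (L : List N) : extProd (m :: L) = ι ℚ m * extProd L := by
  simp [extProd]

theorem sgn_smul_smul {M : Type*} [AddCommGroup M] [Module ℚ M] (n : ℕ) (x : M) :
    sgn n • sgn n • x = x := by
  rcases sgn_or n with h | h <;> rw [h] <;> simp

theorem extProd_mul_ι (L : List N) (m : N) :
    extProd L * ι ℚ m = sgn L.length • (ι ℚ m * extProd L) := by
  induction L with
  | nil => simp [extProd, sgn]
  | cons a L ih =>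
    rw [extProd_cons, mul_assoc, ih, mul_smul_comm, ← mul_assoc, ← mul_assoc,
      eq_neg_of_add_eq_zero_left (ι_add_mul_swap a m), List.length_cons, sgn_add, neg_mul]
    simp [sgn]

/-- This is the Koszul sign rule for two blocks of vertices; all later sign cancellations rest on
it. -/
theorem extProd_comm (L L' : List N) :
    extProd L * extProd L' = sgn (L.length * L'.length) • (extProd L' * extProd L) := by
  induction L' with
  | nil => simp [extProd, sgn]
  | cons a L' ih =>
    rw [extProd_cons, ← mul_assoc, extProd_mul_ι, smul_mul_assoc, mul_assoc, ih, mul_smul_comm,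
      smul_smul, ← sgn_add, mul_assoc, List.length_cons]
    congr 2
    ring

/-- The product over the inner vertices of the vectors `c L R`, where `L`, `R` are the sets of
leaves of the two branches. -/
noncomputable def weight (c : Multiset I →+ Multiset I →+ N) (w : Drawn I) :
    ExteriorAlgebra ℚ N :=
  extProd ((fnodes w).map fun p => c p.1 p.2)

variable (c c' : Multiset I →+ Multiset I →+ N)

@[simp] theorem weight_nil : weight c [] = 1 := by simp [weight, extProd]

theorem weight_append (u v : Drawn I) : weight c (u ++ v) = weight c u * weight c v := by
  simp [weight, extProd_append]

theorem weight_cons (t : BTree I) (v : Drawn I) :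
    weight c (t :: v) = weight c [t] * weight c v := weight_append c [t] v

@[simp] theorem weight_leaf (i : I) : weight c [.leaf i] = 1 := by
  simp [weight, extProd, BTree.nodes]

theorem weight_node (l r : BTree I) :
    weight c [.node l r] = ι ℚ (c l.leaves r.leaves) * (weight c [l] * weight c [r]) := by
  simp [weight, BTree.nodes, extProd_append, extProd_cons]

theorem weight_mul_ι (w : Drawn I) (m : N) :
    weight c w * ι ℚ m = sgn (fdeg w) • (ι ℚ m * weight c w) := by
  rw [weight, extProd_mul_ι, List.length_map, length_fnodes]

theorem weight_comm (u v : Drawn I) :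
    weight c u * weight c' v = sgn (fdeg u * fdeg v) • (weight c' v * weight c u) := by
  rw [weight, weight, extProd_comm, List.length_map, List.length_map, length_fnodes,
    length_fnodes]

/-- The linear extension of `weight`. -/
noncomputable def weightLin : Lin I →ₗ[ℚ] ExteriorAlgebra ℚ N :=
  Finsupp.linearCombination ℚ (weight c)

@[simp] theorem weightLin_single (w : Drawn I) :
    weightLin c (Finsupp.single w 1) = weight c w := by simp [weightLin]

theorem weightLin_pre (u : Drawn I) (x : Lin I) :
    weightLin c (pre u x) = weight c u * weightLin c x := by
  have : weightLin c ∘ₗ pre u = LinearMap.mulLeft ℚ (weight c u) ∘ₗ weightLin c := by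
    apply Finsupp.lhom_ext'
    intro w
    ext1
    simp [pre_single, weight_append]
  exact LinearMap.congr_fun this x

/-- The vectors `c t.leaves s.leaves`, over the trees `s` of `v`, add up to `c t.leaves (fleaves
v)`. The sign in `graftTree` is the one that moves the new vertex and `t` back in front of the trees
that were skipped. -/
theorem weightLin_graftTree (t : BTree I) (v : Drawn I) :
    weightLin c (graftTree t v) =
      ι ℚ (c t.leaves (fleaves v)) * (weight c [t] * weight c v) := by
  induction v with
  | nil => simp [graftTree]
  | cons s v ih =>
    rw [graftTree, map_add, map_smul, weightLin_single, weightLin_pre, ih,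
      weight_cons c (.node t s), weight_node, fleaves_cons, map_add, map_add, add_mul (ι ℚ _), weight_cons c s v]
    congr 1
    · simp only [mul_assoc]
    · rw [← mul_assoc (weight c [s]), weight_mul_ι, smul_mul_assoc, mul_assoc,
        ← mul_assoc (weight c [s]), weight_comm c c [s] [t], smul_mul_assoc, mul_smul_comm,
        smul_smul, smul_smul, ← sgn_add, ← sgn_add, mul_assoc (weight c [t])]
      -- The sign of the definition meets the signs for moving the new vertex and `t` past `s`; the
      -- total exponent is even.
      have : (1 + t.deg) * s.deg + fdeg [s] + fdeg [s] * fdeg [t] =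
          2 * ((1 + t.deg) * s.deg) := by
        simp only [fdeg_cons, fdeg_nil]; ring
      rw [this, sgn, pow_mul]
      simp

/-- The same argument as for `weightLin_graftTree`, now using additivity of `c` in its first
argument. -/
theorem weightLin_graft (u v : Drawn I) :
    weightLin c (graft u v) =
      ι ℚ (c (fleaves u) (fleaves v)) * (weight c u * weight c v) := by
  induction u with
  | nil => simp [graft]
  | cons t u ih =>
    rw [graft, map_add, map_smul, map_smul, weightLin_pre, weightLin_pre, weightLin_graftTree, ih,
      weight_cons c t u, fleaves_cons, map_add, AddMonoidHom.add_apply, map_add, add_mul (ι ℚ _)]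
    congr 1
    · rw [← mul_assoc (weight c u), weight_mul_ι, smul_mul_assoc, mul_assoc,
        ← mul_assoc (weight c u), weight_comm c c u [t], smul_mul_assoc, mul_smul_comm,
        smul_smul, smul_smul, ← sgn_add, ← sgn_add]
      have : (1 + t.deg) * fdeg u + fdeg u + fdeg u * fdeg [t] =
          2 * ((1 + t.deg) * fdeg u) := by
        simp only [fdeg_cons, fdeg_nil]; ring
      rw [this, sgn, pow_mul]
      simp
    · rw [← mul_assoc (weight c [t]), weight_mul_ι, smul_mul_assoc, fdeg_cons, fdeg_nil, add_zero,
        sgn_smul_smul]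
      simp only [mul_assoc]

/-- The product of the weights of the two components of a pair. -/
noncomputable def weight2 : Lin2 I →ₗ[ℚ] ExteriorAlgebra ℚ N :=
  Finsupp.linearCombination ℚ fun p => weight c p.1 * weight c' p.2

@[simp] theorem weight2_single (p : Drawn I × Drawn I) :
    weight2 c c' (Finsupp.single p 1) = weight c p.1 * weight c' p.2 := by simp [weight2]

theorem weight2_tens (x y : Lin I) :
    weight2 c c' (tens x y) = weightLin c x * weightLin c' y := by
  have : tens.compr₂ (weight2 c c') =
      (LinearMap.mul ℚ (ExteriorAlgebra ℚ N)).compl₁₂ (weightLin c) (weightLin c') := by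
    apply bilin_ext
    intro a b
    simp [tens_single]
  exact LinearMap.congr_fun₂ this x y

/-- The Koszul sign of `opE` is the sign for moving the weight of `x.2` past that of `y.1`. Both
components are weighted in the same exterior algebra to make these signs agree. -/
theorem weight_exch (x y : Drawn I × Drawn I) :
    sgn (fdeg x.2 * fdeg y.1) •
      ((weight c x.1 * weight c y.1) * (weight c' x.2 * weight c' y.2)) =
    (weight c x.1 * weight c' x.2) * (weight c y.1 * weight c' y.2) := by
  rw [mul_assoc (weight c x.1) (weight c' x.2), ← mul_assoc (weight c' x.2),
    weight_comm c' c x.2 y.1, smul_mul_assoc, mul_smul_comm]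
  simp only [mul_assoc]

theorem weight2_opE (X Y : Lin2 I) :
    weight2 c c' (opE X Y) = weight2 c c' X * weight2 c c' Y := by
  have : opE.compr₂ (weight2 c c') =
      (LinearMap.mul ℚ (ExteriorAlgebra ℚ N)).compl₁₂ (weight2 c c') (weight2 c c') := by
    apply bilin_ext
    intro x y
    simp only [LinearMap.compr₂_apply, LinearMap.compl₁₂_apply, opE, bilin_single, map_smul,
      weight2_single, weight_append, weight_exch, LinearMap.mul_apply']
  exact LinearMap.congr_fun₂ this X Y

/-- Grafting in the first component contributes `c A B` and grafting in the second `c' A B`. They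
combine into `c + c'` because both components of each pair have the same leaves, which is what
`leafHom2` records. -/
theorem weight2_opOmega {A B : Multiset I} {X Y : Lin2 I} (hX : X ∈ leafHom2 A)
    (hY : Y ∈ leafHom2 B) :
    weight2 c c' (opOmega X Y) =
      ι ℚ ((c + c') A B) * (weight2 c c' X * weight2 c c' Y) := by
  -- The difference of the two sides is bilinear, so it vanishes as soon as it does on generators.
  have h := LinearMap.BilinMap.apply_apply_mem_of_mem_span ⊥ _ _
    (opOmega.compr₂ (weight2 c c') - ((LinearMap.mul ℚ (ExteriorAlgebra ℚ N)).compl₁₂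
      (weight2 c c') (weight2 c c')).compr₂ (LinearMap.mulLeft ℚ (ι ℚ ((c + c') A B))))
    ?_ X Y hX hY
  · simpa [sub_eq_zero] using h
  rintro _ ⟨x, ⟨hx, hx'⟩, rfl⟩ _ ⟨y, ⟨hy, hy'⟩, rfl⟩
  rw [Submodule.mem_bot]
  simp only [LinearMap.sub_apply, LinearMap.compr₂_apply, LinearMap.compl₁₂_apply, opOmega,
    bilin_single, map_smul, map_add, weight2_single, LinearMap.mul_apply',
    LinearMap.mulLeft_apply, weight2_tens, weightLin_graft, weightLin_single, hx, hx', hy, hy',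
    weight_append]
  rw [← weight_exch, sub_eq_zero, AddMonoidHom.add_apply, AddMonoidHom.add_apply, map_add, add_mul (ι ℚ _)]
  congr 1
  · rw [mul_smul_comm, mul_assoc]
  · rw [← weight_append, ← mul_assoc, weight_mul_ι, fdeg_append, mul_smul_comm, smul_mul_assoc,
      smul_smul, ← sgn_add, mul_assoc]
    -- A vertex created in the second component moves to the front past the first component, of
    -- degree `fdeg x.1 + fdeg y.1`. Only the exchange sign of `weight_exch` remains.
    have : fdeg x.1 + (1 + fdeg x.2) * fdeg y.1 + (fdeg x.1 + fdeg y.1) =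
        2 * (fdeg x.1 + fdeg y.1) + fdeg x.2 * fdeg y.1 := by ring
    rw [this, sgn_add, sgn, pow_mul]
    simp

theorem weight2_coprodTree (t : BTree I) :
    weight2 c c' (coprodTree t) = weight (c + c') [t] := by
  induction t with
  | leaf i => simp [coprodTree]
  | node l r hl hr =>
    rw [coprodTree, weight2_opOmega c c' (coprodTree_mem_leafHom2 l) (coprodTree_mem_leafHom2 r),
      hl, hr, weight_node]

/-- The coproduct adds the weights. -/
theorem weight2_coprodDrawn (w : Drawn I) :
    weight2 c c' (coprodDrawn w) = weight (c + c') w := by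
  induction w with
  | nil => simp [coprodDrawn]
  | cons t w ih => rw [coprodDrawn, weight2_opE, weight2_coprodTree, ih, ← weight_cons]

end Weight

/-! ### Products in the dual algebra -/

section Dual

variable [Fintype I]

theorem ofDrawn_eq (w : Forest I) : ofDrawn w.1 = ofForest w := by
  rw [ofDrawn, dif_pos w.2]
  rfl

theorem times_ofForest (φ ψ : BessDual I) (w : Forest I) :
    times φ ψ (ofForest w) =
      Finsupp.linearCombination ℚ (fun p => φ (ofDrawn p.1) * ψ (ofDrawn p.2))
        (coprodDrawn w.1) := by
  have h : coprod I (ofForest w) = ofLin2 (coprodDrawn w.1) := by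
    simp [coprod, ofForest]
  have h2 : LinearMap.mul' ℚ ℚ ∘ₗ TensorProduct.map φ ψ ∘ₗ ofLin2 =
      Finsupp.linearCombination ℚ (fun p => φ (ofDrawn p.1) * ψ (ofDrawn p.2)) := by
    apply Finsupp.lhom_ext'
    intro p
    ext1
    simp [ofLin2]
  rw [← h2]
  simp [times, h]

/-- To compute a product it is enough to know the values of the factors on the terms of the
coproduct. -/
theorem times_ofForest_eq {φ ψ : BessDual I} (f : Lin2 I →ₗ[ℚ] ℚ)
    (h : ∀ u v : Forest I, f (Finsupp.single (u.1, v.1) 1) = φ (ofForest u) * ψ (ofForest v))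
    (w : Forest I) : times φ ψ (ofForest w) = f (coprodDrawn w.1) := by
  rw [times_ofForest]
  -- Every term of the coproduct is a pair of forests on all of `I`, so pairs on which `ofDrawn`
  -- takes its default value `0` need not be tested.
  refine LinearMap.eqOn_span ?_ (coprodDrawn_mem_leafHom2 w.1)
  rintro _ ⟨⟨u, v⟩, ⟨hu, hv⟩, rfl⟩
  obtain ⟨u, rfl⟩ : ∃ u' : Forest I, u'.1 = u := ⟨⟨u, hu.trans w.2⟩, rfl⟩
  obtain ⟨v, rfl⟩ : ∃ v' : Forest I, v'.1 = v := ⟨⟨v, hv.trans w.2⟩, rfl⟩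
  rw [h u v, ← ofDrawn_eq, ← ofDrawn_eq]
  simp

end Dual

/-! ### Products of the elements `Y` as determinants -/

section Determinant

open ExteriorAlgebra

variable [DecidableEq I]

/-- The value of the edge `(a, b)` at an inner vertex: it is nonzero if and only if that vertex is
the last common vertex of the paths from the root to `a` and to `b`. -/
def edgeVal (a b : I) (p : Multiset I × Multiset I) : ℚ :=
  p.1.count a * p.2.count b - p.1.count b * p.2.count a

/-- `edgeVal a b` times a vector, as a biadditive map. -/
noncomputable def edgeHom {N : Type*} [AddCommGroup N] [Module ℚ N] (a b : I) (m : N) :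
    Multiset I →+ Multiset I →+ N where
  toFun A :=
    { toFun := fun B => edgeVal a b (A, B) • m
      map_zero' := by simp [edgeVal]
      map_add' := fun B C => by rw [← add_smul]; congr 1; simp [edgeVal]; ring }
  map_zero' := by ext; simp [edgeVal]
  map_add' A B := by
    apply AddMonoidHom.ext
    intro C
    change edgeVal a b (A + B, C) • m = edgeVal a b (A, C) • m + edgeVal a b (B, C) • m
    rw [← add_smul]; congr 1; simp [edgeVal]; ring

theorem edgeHom_apply {N : Type*} [AddCommGroup N] [Module ℚ N] (a b : I) (m : N)
    (A B : Multiset I) : edgeHom a b m A B = edgeVal a b (A, B) • m := rfl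

/-- The only inner vertex joins two leaves, and for singletons the two products of counts in
`edgeVal` are the two indicators in `yVal`. -/
theorem yVal_of_fnodes (a b : I) {w : Drawn I} {p : Multiset I × Multiset I}
    (h : fnodes w = [p]) : yVal a b w = edgeVal a b p := by
  have hd : fdeg w = 1 := by rw [← length_fnodes, h]; rfl
  unfold yVal
  rw [if_pos hd]
  induction w with
  | nil => simp at h
  | cons t w ih =>
    rw [fdeg_cons] at hd
    rcases Nat.eq_zero_or_pos t.deg with h0 | h0
    · obtain ⟨x, rfl⟩ := deg_eq_zero h0
      simpa using ih h (by omega)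
    · have hw : fdeg w = 0 := by omega
      cases t with
      | leaf x => simp [BTree.deg] at h0
      | node l r =>
        simp only [BTree.deg] at hd
        obtain ⟨x, rfl⟩ := deg_eq_zero (t := l) (by omega)
        obtain ⟨y, rfl⟩ := deg_eq_zero (t := r) (by omega)
        have hn : fnodes w = [] := by rw [← List.length_eq_zero_iff, length_fnodes, hw]
        simp only [fnodes_cons, BTree.nodes, hn, BTree.leaves, List.append_nil,
          List.cons.injEq, and_true] at h
        subst h
        simp only [List.mem_cons, not_mem_of_fdeg hw, or_false, BTree.node.injEq,
          BTree.leaf.injEq, edgeVal, Multiset.count_singleton]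
        simp only [ite_and, Nat.cast_ite, Nat.cast_one, Nat.cast_zero, ite_zero_mul_ite_zero,
          mul_one]

/-- All vertices carry multiples of the same `m`, so two or more of them give zero. This exhibits `Y
a b` as the coefficient of `m` in a weight. -/
theorem weight_edgeHom {N : Type*} [AddCommGroup N] [Module ℚ N] (a b : I) (m : N) (w : Drawn I) :
    weight (edgeHom a b m) w =
      algebraMap ℚ _ (if fdeg w = 0 then 1 else 0) + yVal a b w • ι ℚ m := by
  have hlen := length_fnodes w
  unfold weight
  rcases hw : fnodes w with _ | ⟨p, _ | ⟨q, L⟩⟩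
  · rw [hw] at hlen
    simp [← hlen, extProd, yVal]
  · rw [yVal_of_fnodes a b hw]
    rw [hw] at hlen
    simp [← hlen, extProd, edgeHom_apply]
  · rw [hw] at hlen
    simp only [List.length_cons] at hlen
    have h0 : fdeg w ≠ 0 := by omega
    have h1 : fdeg w ≠ 1 := by omega
    simp only [yVal, h0, h1, if_false, List.map_cons, extProd_cons, edgeHom_apply, map_smul,
      map_zero, zero_smul, add_zero]
    rw [← mul_assoc, smul_mul_smul_comm, ι_sq_zero, smul_zero, zero_mul]

/-- The alternating forms which define `topForm`. -/
noncomputable def topAlternating : (n : ℕ) → (Fin 3 → ℚ) [⋀^Fin n]→ₗ[ℚ] ℚ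
  | 3 => Matrix.detRowAlternating
  | _ => 0

/-- The coefficient of the top exterior power of `ℚ³`. -/
noncomputable def topForm : ExteriorAlgebra ℚ (Fin 3 → ℚ) →ₗ[ℚ] ℚ :=
  liftAlternating topAlternating

theorem topForm_extProd (L : List (Fin 3 → ℚ)) :
    topForm (extProd L) = topAlternating L.length L.get := by
  rw [topForm, ← liftAlternating_apply_ιMulti, ιMulti_apply, extProd]
  congr 2
  simp [← Function.comp_def]

theorem topForm_extProd_three (x y z : Fin 3 → ℚ) :
    topForm (extProd [x, y, z]) = Matrix.det ![x, y, z] := by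
  rw [topForm_extProd]
  change Matrix.det _ = _
  congr 1
  ext i j
  fin_cases i <;> rfl

theorem topForm_extProd_of_ne {L : List (Fin 3 → ℚ)} (h : L.length ≠ 3) :
    topForm (extProd L) = 0 := by
  rw [topForm_extProd]
  -- The type of `L.get` depends on `L.length`, so both are generalized before the case split on the
  -- length.
  generalize L.get = v
  revert v
  generalize L.length = n at h
  intro v
  unfold topAlternating
  split
  · exact absurd rfl h
  · rfl

/-! ### Values of double and triple products of the elements `Y` -/

variable [Fintype I]

theorem Y_ofForest (a b : I) (w : Forest I) : Y a b (ofForest w) = yVal a b w.1 := by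
  simp [Y, ofForest]

/-- The basis of `ℚ³`. -/
abbrev stdVec (i : Fin 3) : Fin 3 → ℚ := Pi.single i 1

/-- Only the product of the three linear terms has degree 3; the constants `s`, `t`, `u` contribute
to lower degrees. -/
theorem topForm_expand (s t u x y z : ℚ) :
    topForm ((algebraMap ℚ _ s + x • ι ℚ (stdVec 0)) * (algebraMap ℚ _ t + y • ι ℚ (stdVec 1)) *
      (algebraMap ℚ _ u + z • ι ℚ (stdVec 2))) = x * y * z := by
  have h0 : topForm 1 = 0 := by
    simpa [extProd] using topForm_extProd_of_ne (L := []) (by simp)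
  have h1 : ∀ m, topForm (ι ℚ m) = 0 := fun m => by
    simpa [extProd] using topForm_extProd_of_ne (L := [m]) (by simp)
  have h2 : ∀ m n, topForm (ι ℚ m * ι ℚ n) = 0 := fun m n => by
    simpa [extProd] using topForm_extProd_of_ne (L := [m, n]) (by simp)
  have h3 : topForm (ι ℚ (stdVec 0) * (ι ℚ (stdVec 1) * ι ℚ (stdVec 2))) = 1 := by
    have h := topForm_extProd_three (stdVec 0) (stdVec 1) (stdVec 2)
    have e : Matrix.det ![stdVec 0, stdVec 1, stdVec 2] = 1 := by
      rw [← Matrix.det_one (n := Fin 3)]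
      congr 1
      ext i j
      fin_cases i <;> fin_cases j <;> rfl
    simpa [extProd, e] using h
  simp only [Algebra.algebraMap_eq_smul_one, add_mul, mul_add, smul_mul_assoc, mul_smul_comm,
    one_mul, mul_one, map_add, map_smul, h0, h1, h2, h3, mul_assoc, smul_eq_mul, mul_zero,
    zero_add, add_zero]
  ring

/-- The double product is read off as a coefficient of degree 2, completed to the top degree by the
factor `s + z e₂`. This factor has the shape that `weight_edgeHom` gives to the third weight. -/
theorem times_Y_ofForest (a b c d : I) (s z : ℚ) (w : Forest I) :
    topForm (weight (edgeHom a b (stdVec 0) + edgeHom c d (stdVec 1)) w.1 *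
      (algebraMap ℚ _ s + z • ι ℚ (stdVec 2))) = times (Y a b) (Y c d) (ofForest w) * z := by
  rw [← weight2_coprodDrawn]
  -- The scalar `z` is absorbed into the second factor to match the form of `times_ofForest_eq`.
  have := times_ofForest_eq (φ := Y a b) (ψ := z • Y c d)
    (topForm ∘ₗ LinearMap.mulRight ℚ (algebraMap ℚ _ s + z • ι ℚ (stdVec 2)) ∘ₗ
      weight2 (edgeHom a b (stdVec 0)) (edgeHom c d (stdVec 1))) (fun u v => ?_) w
  · rw [LinearMap.comp_apply, LinearMap.comp_apply, LinearMap.mulRight_apply] at this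
    rw [← this]
    simp [times, TensorProduct.map_smul_right, mul_comm]
  · rw [LinearMap.comp_apply, LinearMap.comp_apply, LinearMap.mulRight_apply, weight2_single,
      weight_edgeHom, weight_edgeHom, topForm_expand]
    simp only [LinearMap.smul_apply, smul_eq_mul, Y_ofForest]
    ring

/-- By additivity of weights under the coproduct, the three edges become the three coordinates of
one vector at each inner vertex. -/
theorem times_times_Y_ofForest (a b c d e f : I) (w : Forest I) :
    times (times (Y a b) (Y c d)) (Y e f) (ofForest w) =
      topForm (extProd ((fnodes w.1).map fun p =>
        ![edgeVal a b p, edgeVal c d p, edgeVal e f p])) := by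
  rw [times_ofForest_eq (topForm ∘ₗ weight2
      (edgeHom a b (stdVec 0) + edgeHom c d (stdVec 1)) (edgeHom e f (stdVec 2))) (fun u v => ?_)]
  · rw [LinearMap.comp_apply, weight2_coprodDrawn, weight]
    congr 3
    funext p
    ext i
    fin_cases i <;> simp [edgeHom_apply]
  · rw [LinearMap.comp_apply, weight2_single, weight_edgeHom e f, times_Y_ofForest, Y_ofForest]

theorem times_times_Y_of_fdeg_ne (a b c d e f : I) {w : Forest I} (h : fdeg w.1 ≠ 3) :
    times (times (Y a b) (Y c d)) (Y e f) (ofForest w) = 0 := by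
  rw [times_times_Y_ofForest]
  exact topForm_extProd_of_ne (by rwa [List.length_map, length_fnodes])

/-- The determinant of the values at three inner vertices of the three edges of the path
`a`, `b`, `c`, `d`. -/
def pathDet (a b c d : I) (x y z : Multiset I × Multiset I) : ℚ :=
  Matrix.det !![edgeVal a b x, edgeVal b c x, edgeVal c d x;
    edgeVal a b y, edgeVal b c y, edgeVal c d y;
    edgeVal a b z, edgeVal b c z, edgeVal c d z]

theorem times_times_Y_of_fnodes (a b c d : I) {w : Forest I}
    {x y z : Multiset I × Multiset I} (h : fnodes w.1 = [x, y, z]) :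
    times (times (Y a b) (Y b c)) (Y c d) (ofForest w) = pathDet a b c d x y z := by
  rw [times_times_Y_ofForest, h]
  exact topForm_extProd_three _ _ _

end Determinant

/-! ### Sums over paths -/

section Paths

/-! ### Leaves and shapes of small trees -/

theorem BTree.card_leaves (t : BTree I) : t.leaves.card = t.deg + 1 := by
  induction t with
  | leaf i => simp [BTree.leaves, BTree.deg]
  | node l r hl hr => simp [BTree.leaves, BTree.deg, hl, hr]; omega

theorem BTree.mem_leaves_of_mem_nodes {t : BTree I} {p : Multiset I × Multiset I}
    (hp : p ∈ t.nodes) {x : I} (hx : x ∈ p.1 + p.2) : x ∈ t.leaves := by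
  induction t with
  | leaf i => simp [BTree.nodes] at hp
  | node l r hl hr =>
    simp only [BTree.nodes, List.mem_cons, List.mem_append] at hp
    rw [BTree.leaves, Multiset.mem_add]
    rcases hp with rfl | hp | hp
    · exact Multiset.mem_add.1 hx
    · exact .inl (hl hp)
    · exact .inr (hr hp)

theorem mem_fleaves_of_mem_fnodes {w : Drawn I} {p : Multiset I × Multiset I}
    (hp : p ∈ fnodes w) {x : I} (hx : x ∈ p.1 + p.2) : x ∈ fleaves w := by
  induction w with
  | nil => simp at hp
  | cons t w ih =>
    rw [fnodes_cons, List.mem_append] at hp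
    rw [fleaves_cons, Multiset.mem_add]
    exact hp.imp (fun h => BTree.mem_leaves_of_mem_nodes h hx) ih

theorem BTree.exists_of_deg_eq_one {t : BTree I} (h : t.deg = 1) :
    ∃ p q, t = .node (.leaf p) (.leaf q) := by
  cases t with
  | leaf x => simp [BTree.deg] at h
  | node l r =>
    simp only [BTree.deg] at h
    obtain ⟨x, rfl⟩ := deg_eq_zero (t := l) (by omega)
    obtain ⟨y, rfl⟩ := deg_eq_zero (t := r) (by omega)
    exact ⟨x, y, rfl⟩

theorem BTree.exists_of_deg_eq_two {t : BTree I} (h : t.deg = 2) :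
    ∃ p q r, t = .node (.node (.leaf p) (.leaf q)) (.leaf r) ∨
      t = .node (.leaf p) (.node (.leaf q) (.leaf r)) := by
  cases t with
  | leaf x => simp [BTree.deg] at h
  | node l r =>
    simp only [BTree.deg] at h
    obtain h0 | h0 : l.deg = 0 ∨ r.deg = 0 := by omega
    · obtain ⟨p, rfl⟩ := deg_eq_zero h0
      obtain ⟨q, r, rfl⟩ := exists_of_deg_eq_one (t := r) (by simp [BTree.deg] at h; omega)
      exact ⟨p, q, r, .inr rfl⟩
    · obtain ⟨r, rfl⟩ := deg_eq_zero h0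
      obtain ⟨p, q, rfl⟩ := exists_of_deg_eq_one (t := l) (by simp [BTree.deg] at h; omega)
      exact ⟨p, q, r, .inl rfl⟩

/-- The five shapes of trees with three inner vertices. -/
theorem BTree.exists_of_deg_eq_three {t : BTree I} (h : t.deg = 3) :
    ∃ p q r s, t = .node (.node (.node (.leaf p) (.leaf q)) (.leaf r)) (.leaf s) ∨
      t = .node (.node (.leaf p) (.node (.leaf q) (.leaf r))) (.leaf s) ∨
      t = .node (.node (.leaf p) (.leaf q)) (.node (.leaf r) (.leaf s)) ∨
      t = .node (.leaf p) (.node (.node (.leaf q) (.leaf r)) (.leaf s)) ∨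
      t = .node (.leaf p) (.node (.leaf q) (.node (.leaf r) (.leaf s))) := by
  cases t with
  | leaf x => simp [BTree.deg] at h
  | node l r =>
    simp only [BTree.deg] at h
    obtain h0 | h0 | h0 : l.deg = 0 ∨ r.deg = 0 ∨ l.deg = 1 ∧ r.deg = 1 := by omega
    · obtain ⟨p, rfl⟩ := deg_eq_zero h0
      obtain ⟨q, r, s, rfl | rfl⟩ := exists_of_deg_eq_two (t := r) (by simp [BTree.deg] at h; omega)
      · exact ⟨p, q, r, s, by simp⟩
      · exact ⟨p, q, r, s, by simp⟩
    · obtain ⟨s, rfl⟩ := deg_eq_zero h0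
      obtain ⟨p, q, r, rfl | rfl⟩ := exists_of_deg_eq_two (t := l) (by simp [BTree.deg] at h; omega)
      · exact ⟨p, q, r, s, by simp⟩
      · exact ⟨p, q, r, s, by simp⟩
    · obtain ⟨p, q, rfl⟩ := exists_of_deg_eq_one h0.1
      obtain ⟨r, s, rfl⟩ := exists_of_deg_eq_one h0.2
      exact ⟨p, q, r, s, by simp⟩

/-- Numbering the four leaves of a tree in planar order reduces the sum over orders to one over
permutations of `Fin 4`. -/
theorem exists_equiv {K : Finset I} (hK : K.card = 4) {p q r s : I}
    (h : K.val = {p} + {q} + {r} + {s}) :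
    ∃ g : Fin 4 ≃ K, (g 0 : I) = p ∧ (g 1 : I) = q ∧ (g 2 : I) = r ∧ (g 3 : I) = s := by
  have hmem : ∀ x, x ∈ K ↔ x = p ∨ x = q ∨ x = r ∨ x = s := fun x => by
    rw [← Finset.mem_val, h]; simp
  let F : Fin 4 → K := ![⟨p, by simp [hmem]⟩, ⟨q, by simp [hmem]⟩, ⟨r, by simp [hmem]⟩,
    ⟨s, by simp [hmem]⟩]
  have hF : Function.Surjective F := by
    rintro ⟨x, hx⟩
    rcases (hmem x).1 hx with rfl | rfl | rfl | rfl
    exacts [⟨0, rfl⟩, ⟨1, rfl⟩, ⟨2, rfl⟩, ⟨3, rfl⟩]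
  exact ⟨Equiv.ofBijective F ((Fintype.bijective_iff_surjective_and_card F).2
    ⟨hF, by simp [hK]⟩), rfl, rfl, rfl, rfl⟩

/-! ### Vanishing of the sum of the path determinants -/

variable [DecidableEq I]

theorem edgeVal_swap (a b : I) (p : Multiset I × Multiset I) :
    edgeVal b a p = -edgeVal a b p := by
  unfold edgeVal; ring

/-- Reversal exchanges the outer columns and negates all three columns: four sign changes. -/
theorem pathDet_reverse (a b c d : I) (x y z : Multiset I × Multiset I) :
    pathDet d c b a x y z = pathDet a b c d x y z := by
  unfold pathDet
  rw [Matrix.det_fin_three, Matrix.det_fin_three]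
  simp only [edgeVal_swap a b, edgeVal_swap b c, edgeVal_swap c d, Matrix.of_apply,
    Matrix.cons_val', Matrix.cons_val_zero, Matrix.cons_val_one, Matrix.cons_val,
    Matrix.cons_val_fin_one]
  ring

theorem mem_of_edgeVal_ne_zero {a b : I} {p : Multiset I × Multiset I} (h : edgeVal a b p ≠ 0) :
    a ∈ p.1 + p.2 ∧ b ∈ p.1 + p.2 := by
  simp only [Multiset.mem_add]
  constructor
  · by_contra! hn
    exact h (by simp [edgeVal, Multiset.count_eq_zero_of_notMem hn.1,
      Multiset.count_eq_zero_of_notMem hn.2])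
  · by_contra! hn
    exact h (by simp [edgeVal, Multiset.count_eq_zero_of_notMem hn.1,
      Multiset.count_eq_zero_of_notMem hn.2])

/-- A nonzero determinant has no zero row (a vertex met by no edge) and no zero column (an edge
meeting no vertex). -/
theorem edgeVal_ne_zero_of_pathDet {a b c d : I} {x y z : Multiset I × Multiset I}
    (h : pathDet a b c d x y z ≠ 0) :
    (∀ p ∈ [x, y, z], edgeVal a b p ≠ 0 ∨ edgeVal b c p ≠ 0 ∨ edgeVal c d p ≠ 0) ∧
    (∃ p ∈ [x, y, z], edgeVal a b p ≠ 0) ∧ (∃ p ∈ [x, y, z], edgeVal b c p ≠ 0) ∧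
    (∃ p ∈ [x, y, z], edgeVal c d p ≠ 0) := by
  simp only [List.forall_mem_cons, List.exists_mem_cons_iff, List.not_mem_nil, false_and,
    exists_false, or_false, false_imp_iff, implies_true, and_true]
  refine ⟨⟨?_, ?_, ?_⟩, ?_, ?_, ?_⟩
  all_goals
    by_contra! hn
    apply h
    unfold pathDet
    rw [Matrix.det_fin_three]
    simp [hn]

/-- If the path `a`, `b`, `c`, `d` contributes to a forest then all inner vertices and the leaves
`a`, `b`, `c`, `d` lie in one tree. -/
theorem exists_tree_of_edges {a b c d : I} {w : Drawn I} (hw : (fleaves w).Nodup)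
    (hr : ∀ p ∈ fnodes w, edgeVal a b p ≠ 0 ∨ edgeVal b c p ≠ 0 ∨ edgeVal c d p ≠ 0)
    (hab : ∃ p ∈ fnodes w, edgeVal a b p ≠ 0) (hbc : ∃ p ∈ fnodes w, edgeVal b c p ≠ 0)
    (hcd : ∃ p ∈ fnodes w, edgeVal c d p ≠ 0) :
    ∃ t : BTree I, t.nodes = fnodes w ∧ ∀ x ∈ [a, b, c, d], x ∈ t.leaves := by
  induction w with
  | nil => simp at hab
  | cons t w ih =>
    rw [fleaves_cons, Multiset.nodup_add] at hw
    have key : ∀ {u v : I} {p}, edgeVal u v p ≠ 0 →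
        (p ∈ t.nodes → u ∈ t.leaves ∧ v ∈ t.leaves) ∧
        (p ∈ fnodes w → u ∈ fleaves w ∧ v ∈ fleaves w) := fun h =>
      ⟨fun hp => (mem_of_edgeVal_ne_zero h).imp (BTree.mem_leaves_of_mem_nodes hp)
        (BTree.mem_leaves_of_mem_nodes hp), fun hp => (mem_of_edgeVal_ne_zero h).imp
        (mem_fleaves_of_mem_fnodes hp) (mem_fleaves_of_mem_fnodes hp)⟩
    have hdis : ∀ {x}, x ∈ t.leaves → x ∈ fleaves w → False := fun h h' =>
      Multiset.disjoint_left.1 hw.2.2 h h'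
    rw [fnodes_cons] at hr hab hbc hcd ⊢
    rcases ht : t.nodes with _ | ⟨p, L⟩
    · rw [ht, List.nil_append] at hr hab hbc hcd
      exact ih hw.2.1 hr hab hbc hcd
    rcases hf : fnodes w with _ | ⟨q, L'⟩
    · rw [hf, List.append_nil] at hab hbc hcd
      obtain ⟨p1, hp1, h1⟩ := hab
      obtain ⟨p3, hp3, h3⟩ := hcd
      -- The first and third edges already cover all four points of the path.
      refine ⟨t, by rw [ht, List.append_nil], ?_⟩
      simp [(key h1).1 hp1, (key h3).1 hp3]
    -- Now both `t` and `w` contain inner vertices. Each of these is met by an edge, so the path has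
    -- points on both sides; but every edge has both ends on one side, and the sides share no leaf.
    -- This contradicts the connectedness of the path.
    exfalso
    have hp : p ∈ t.nodes := by simp [ht]
    have hq : q ∈ fnodes w := by simp [hf]
    have hrp := hr p (List.mem_append_left _ hp)
    have hrq := hr q (List.mem_append_right _ hq)
    obtain ⟨p1, hp1, h1⟩ := hab
    obtain ⟨p2, hp2, h2⟩ := hbc
    obtain ⟨p3, hp3, h3⟩ := hcd
    rw [List.mem_append] at hp1 hp2 hp3
    have k1 := hp1.imp (key h1).1 (key h1).2
    have k2 := hp2.imp (key h2).1 (key h2).2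
    have k3 := hp3.imp (key h3).1 (key h3).2
    have kp := hrp.imp (fun h => (key h).1 hp)
      (Or.imp (fun h => (key h).1 hp) (fun h => (key h).1 hp))
    have kq := hrq.imp (fun h => (key h).2 hq)
      (Or.imp (fun h => (key h).2 hq) (fun h => (key h).2 hq))
    have da := @hdis a
    have db := @hdis b
    have dc := @hdis c
    have dd := @hdis d
    clear hr hrp hrq key hdis ih h1 h2 h3 hp1 hp2 hp3
    grind

theorem edgeVal_map {J : Type*} [DecidableEq J] {g : J → I} (hg : Function.Injective g)
    (a b : J) (A B : Multiset J) : edgeVal (g a) (g b) (A.map g, B.map g) = edgeVal a b (A, B) := by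
  simp [edgeVal, Multiset.count_map_eq_count' _ _ hg]

/-- An injective relabelling preserves counts, hence `edgeVal`, and every order is `g` composed with
a unique permutation. -/
theorem sum_pathDet_map {K : Finset I} (g : Fin 4 ≃ K) {A B C A' B' C' : Multiset (Fin 4)}
    (h : ∑ σ : Equiv.Perm (Fin 4),
      pathDet (σ 0) (σ 1) (σ 2) (σ 3) (A, A') (B, B') (C, C') = 0) :
    ∑ f : Fin 4 ≃ K, pathDet (f 0 : I) (f 1) (f 2) (f 3)
      (A.map fun i => (g i : I), A'.map fun i => (g i : I))
      (B.map fun i => (g i : I), B'.map fun i => (g i : I))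
      (C.map fun i => (g i : I), C'.map fun i => (g i : I)) = 0 := by
  have hg : Function.Injective fun i => (g i : I) := Subtype.val_injective.comp g.injective
  rw [← h, ← Equiv.sum_comp (Equiv.equivCongr (Equiv.refl (Fin 4)) g)]
  refine Finset.sum_congr rfl fun σ _ => ?_
  simp only [pathDet, ← edgeVal_map hg]
  rfl

/-- Some inner vertex joins two leaves, and transposing them negates exactly one row of each
determinant. -/
theorem sum_pathDet_tree {K : Finset I} (hK : K.card = 4) {t : BTree I} (ht : ∀ a ∈ K, a ∈ t.leaves)
    {x y z : Multiset I × Multiset I} (hn : t.nodes = [x, y, z]) :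
    ∑ f : Fin 4 ≃ K, pathDet (f 0 : I) (f 1) (f 2) (f 3) x y z = 0 := by
  have hd : t.deg = 3 := by rw [← BTree.length_nodes, hn]; rfl
  -- Three inner vertices mean four leaves, so the tree has no leaf outside `K` and none repeated.
  have hl : K.val = t.leaves := by
    refine Multiset.eq_of_le_of_card_le ((Multiset.le_iff_subset K.nodup).2 ht) ?_
    rw [BTree.card_leaves, hd]
    exact hK.ge
  obtain ⟨p, q, r, s, h⟩ := BTree.exists_of_deg_eq_three hd
  have hl' : K.val = {p} + {q} + {r} + {s} := by
    rw [hl]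
    rcases h with rfl | rfl | rfl | rfl | rfl <;> simp only [BTree.leaves, add_assoc]
  obtain ⟨g, rfl, rfl, rfl, rfl⟩ := exists_equiv hK hl'
  rcases h with rfl | rfl | rfl | rfl | rfl <;>
    simp only [BTree.nodes, BTree.leaves, List.cons_append, List.nil_append, List.append_nil,
      List.cons.injEq, and_true] at hn <;> obtain ⟨rfl, rfl, rfl⟩ := hn
  -- For each shape, the branches at the three vertices are written in the planar numbering and the
  -- 24 determinants are evaluated.
  · exact sum_pathDet_map g (A := {0} + {1} + {2}) (A' := {3}) (B := {0} + {1}) (B' := {2})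
      (C := {0}) (C' := {1}) (by decide +kernel)
  · exact sum_pathDet_map g (A := {0} + ({1} + {2})) (A' := {3}) (B := {0}) (B' := {1} + {2})
      (C := {1}) (C' := {2}) (by decide +kernel)
  · exact sum_pathDet_map g (A := {0} + {1}) (A' := {2} + {3}) (B := {0}) (B' := {1})
      (C := {2}) (C' := {3}) (by decide +kernel)
  · exact sum_pathDet_map g (A := {0}) (A' := {1} + {2} + {3}) (B := {1} + {2}) (B' := {3})
      (C := {1}) (C' := {2}) (by decide +kernel)
  · exact sum_pathDet_map g (A := {0}) (A' := {1} + ({2} + {3})) (B := {1}) (B' := {2} + {3})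
      (C := {2}) (C' := {3}) (by decide +kernel)

/-- A single contributing order is enough to locate a tree containing `K` and all three inner
vertices; the whole sum is then the sum for that tree. -/
theorem sum_pathDet_forest {K : Finset I} (hK : K.card = 4) {w : Drawn I} (hw : (fleaves w).Nodup)
    {x y z : Multiset I × Multiset I} (hn : fnodes w = [x, y, z]) :
    ∑ f : Fin 4 ≃ K, pathDet (f 0 : I) (f 1) (f 2) (f 3) x y z = 0 := by
  by_contra hne
  obtain ⟨f, -, hf⟩ := Finset.exists_ne_zero_of_sum_ne_zero hne
  obtain ⟨h0, h1, h2, h3⟩ := edgeVal_ne_zero_of_pathDet hf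
  rw [← hn] at h0 h1 h2 h3
  obtain ⟨t, ht, hl⟩ := exists_tree_of_edges hw h0 h1 h2 h3
  refine hne (sum_pathDet_tree hK (fun a ha => hl a ?_) (ht.trans hn))
  obtain ⟨m, hm⟩ := f.surjective ⟨a, ha⟩
  obtain rfl : (f m : I) = a := by rw [hm]
  fin_cases m <;> simp

variable [Fintype I]

theorem times_times_Y_reverse (a b c d : I) (w : Forest I) :
    times (times (Y d c) (Y c b)) (Y b a) (ofForest w) =
      times (times (Y a b) (Y b c)) (Y c d) (ofForest w) := by
  by_cases hd : fdeg w.1 = 3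
  · obtain ⟨x, y, z, h⟩ := List.length_eq_three.1 ((length_fnodes w.1).trans hd)
    rw [times_times_Y_of_fnodes _ _ _ _ h, times_times_Y_of_fnodes _ _ _ _ h, pathDet_reverse]
  · rw [times_times_Y_of_fdeg_ne _ _ _ _ _ _ hd, times_times_Y_of_fdeg_ne _ _ _ _ _ _ hd]

/-- The sum over all total orders on a set with four elements. -/
theorem sum_times_times_Y {K : Finset I} (hK : K.card = 4) (w : Forest I) :
    ∑ f : Fin 4 ≃ K, times (times (Y (f 0 : I) (f 1)) (Y (f 1 : I) (f 2))) (Y (f 2 : I) (f 3))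
      (ofForest w) = 0 := by
  by_cases hd : fdeg w.1 = 3
  · obtain ⟨x, y, z, h⟩ := List.length_eq_three.1 ((length_fnodes w.1).trans hd)
    simp only [times_times_Y_of_fnodes _ _ _ _ h]
    exact sum_pathDet_forest hK (by rw [w.2]; exact Finset.univ.nodup) h
  · exact Finset.sum_eq_zero fun f _ => times_times_Y_of_fdeg_ne _ _ _ _ _ _ hd

end Paths

/-! ### Reduction to values on forests, and from all orders to representatives -/

theorem bessDual_ext [Fintype I] {φ ψ : BessDual I}
    (h : ∀ w : Forest I, φ (ofForest w) = ψ (ofForest w)) : φ = ψ := by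
  apply Submodule.linearMap_qext
  apply Finsupp.lhom_ext'
  intro w
  ext
  exact h w

/-- A sum over a set of representatives modulo an involution which preserves the summand. -/
theorem sum_eq_zero_of_xor {α : Type*} [Fintype α] {S : Finset α} {ρ : α → α}
    (hρ : Function.Involutive ρ) (hS : ∀ f, Xor (f ∈ S) (ρ f ∈ S)) {T : α → ℚ}
    (hT : ∀ f, T (ρ f) = T f) (h : ∑ f, T f = 0) : ∑ f ∈ S, T f = 0 := by
  classical
  -- The involution exchanges `S` with its complement, so the total sum is twice the sum over `S`.
  have hc : ∑ f ∈ Sᶜ, T f = ∑ f ∈ S, T f := by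
    refine Finset.sum_nbij' ρ ρ ?_ ?_ (fun f _ => hρ f) (fun f _ => hρ f) fun f _ => (hT f).symm
    · intro f hf
      rw [Finset.mem_compl] at hf
      exact (hS f).elim (fun h => absurd h.1 hf) (fun h => h.1)
    · intro f hf
      rw [Finset.mem_compl]
      exact (hS f).elim (fun h => h.2) (fun h => absurd hf h.2)
  rw [← Finset.sum_add_sum_compl S, hc] at h
  linarith

end Bessel

theorem mainTheorem10 {I : Type*} [Fintype I] [DecidableEq I] (i j k l : I)
    (hdistinct : [i, j, k, l].Nodup)
    (S : Finset (Fin 4 ≃ ({i, j, k, l} : Finset I)))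
    (hS : ∀ f : Fin 4 ≃ ({i, j, k, l} : Finset I), Xor (f ∈ S) (Fin.revPerm.trans f ∈ S)) :
    ∑ f ∈ S, Bessel.times
        (Bessel.times (Bessel.Y (f 0 : I) (f 1 : I)) (Bessel.Y (f 1 : I) (f 2 : I)))
        (Bessel.Y (f 2 : I) (f 3 : I)) = 0 := by
  have hK : ({i, j, k, l} : Finset I).card = 4 := by
    have := List.toFinset_card_of_nodup hdistinct
    simpa using this
  refine Bessel.bessDual_ext fun w => ?_
  rw [LinearMap.sum_apply, LinearMap.zero_apply]
  refine Bessel.sum_eq_zero_of_xor (ρ := fun f => Fin.revPerm.trans f) (fun f => ?_) hS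
    (fun f => ?_) (Bessel.sum_times_times_Y hK w)
  · ext m
    simp
  · exact Bessel.times_times_Y_reverse _ _ _ _ w
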